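/- **Setting.** Let $E=(E^0,E^1,r,s)$ be a finite directed graph with adjacency matrix $A_E(v,w)=|\{e\in E^1: r(e)=v,\ s(e)=w\}|$, and let $\rho(A_E)$ be the spectral radius of $A_E$. For $n\ge 0$ let $E^n$ be the set of paths $e_1\cdots e_n$ with $r(e_{i+1})=s(e_i)$ (with $E^0$ the set of vertices), let $E^*=\bigcup_{n\ge 0}E^n$, and let $vE^*$, $vE^n$ be the paths in $E^*$, $E^n$ with range $v$. Let $\mathcal G$ be a discrete groupoid with unit space $E^0$, domain map $d$ and terminus map $t$, and let $\mathcal G\curvearrowright E$ be a faithful self-similar action: each $g\in\mathcal G$ acts by a length-preserving bijection $d(g)E^*\to t(g)E^*$, $\mu\mapsto g\cdot\mu$, with $g\cdot(\mu e)\in (g\cdot\mu)E^1$; units act as identities and products as compositions; distinct elements of $\mathcal G$ with the same domain and the same terminus act differently; and for all $g\in\mathcal G$ and $\mu\in d(g)E^*$ there is an element $g|_\mu\in\mathcal G$ (necessarily unique) with domain $s(\mu)$ such that $g\cdot(\mu\nu)=(g\cdot\mu)(g|_\mu\cdot\nu)$ for all $\nu\in s(\mu)E^*$. Let $C^*(\mathcal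 G)$ be the full $C^*$-algebra of $\mathcal G$, that is, the universal unital $C^*$-algebra generated by elements $u_g$ $(g\in\mathcal G)$ with $u_gu_h=u_{gh}$ if $d(g)=t(h)$ and $u_gu_h=0$ otherwise, $u_{g^{-1}}=u_g^*$ and $\sum_{v\in E^0}u_v=1$. Let $\operatorname{Tr}(C^*(\mathcal G))$ be the set of its tracial states. Let $\mathcal T(\mathcal G,E)$ be the Toeplitz algebra, that is, the universal unital $C^*$-algebra generated by such elements $u_g$ together with elements $s_e$ $(e\in E^1)$ such that $s_e^*s_e=u_{s(e)}$, $\sum_{r(e)=w}s_es_e^*\le u_w$ for all $w\in E^0$, and $u_gs_e=s_{g\cdot e}u_{g|_e}$ if $d(g)=r(e)$ while $u_gs_e=0$ otherwise; it receives a canonical unital $*$-homomorphism from $C^*(\mathcal G)$, $u_g\mapsto u_g$. For $\mu=e_1\cdots e_n$ put $s_\mu=s_{e_1}\cdots s_{e_n}$, and for a vertex $v$ put $s_v=u_v$. Let $\beta\in\mathbb R$ with $\beta>\log\rho(A_E)$ (where $\log 0=-\infty$). For $\tau\in\operatorname{Tr}(C^*(\mathcal G))$ let $$Z(\beta,\tau)=\sum_{k=0}^\infty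 e^{-\beta k}\sum_{\mu\in E^k}\tau(u_{s(\mu)})\in(0,\infty),\qquad N(\beta,\tau)=e^{\beta}\bigl(1-Z(\beta,\tau)^{-1}\bigr),$$ and let $\Psi_{\beta,\tau}$ be the state of $\mathcal T(\mathcal G,E)$ given, for $\mu,\nu\in E^*$ and $g\in\mathcal G$ with $d(g)=s(\nu)$ and $t(g)=s(\mu)$, by $$\Psi_{\beta,\tau}(s_\mu u_gs_\nu^*)=\delta_{\mu,\nu}\,e^{-\beta|\mu|}Z(\beta,\tau)^{-1}\sum_{k=0}^\infty e^{-\beta k}\sum_{\lambda\in s(\mu)E^k,\ g\cdot\lambda=\lambda}\tau(u_{g|_\lambda}).$$ Let $\chi_\beta:\operatorname{Tr}(C^*(\mathcal G))\to\operatorname{Tr}(C^*(\mathcal G))$ be the map that sends $\tau$ to the restriction of $\Psi_{\beta,\tau}$ to $C^*(\mathcal G)$. **Proposition.** (1) If $\tau\in\operatorname{Tr}(C^*(\mathcal G))$ satisfies $\chi_\beta(\tau)=\tau$, then for every $g\in\mathcal G$ $$N(\beta,\tau)^n\,\tau(u_g)=\sum_{\mu\in d(g)E^n,\ g\cdot\mu=\mu}\tau(u_{g|_\mu})\qquad\text{for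 all } n\ge 1.\tag{$*$}$$ (2) Suppose that $E$ is strongly connected, that is, for all $v,w\in E^0$ there is a path in $E^*$ with range $v$ and source $w$. If $\tau\in\operatorname{Tr}(C^*(\mathcal G))$ satisfies $(*)$ for every $g\in\mathcal G$, then $m=(\tau(u_v))_{v\in E^0}$ is the Perron–Frobenius eigenvector of $A_E$, that is, $m_v>0$ for all $v$, $\sum_{v}m_v=1$ and $A_Em=\rho(A_E)\,m$; moreover $N(\beta,\tau)=\rho(A_E)$. -/

import Mathlib

open CategoryTheory
open scoped ENNReal ComplexOrder InnerProductSpace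

set_option linter.unusedSectionVars false

universe u

/-- A directed graph with vertex set `V`, edge set `E`, range map `r` and source map `s`. -/
structure DirGraph (V E : Type u) where
  r : E → V
  s : E → V

namespace DirGraph

variable {V E : Type u} (Γ : DirGraph V E)

/-- The list `e₁, …, eₙ` of edges is a path with range `v`:
`r e₁ = v` and `r eᵢ₊₁ = s eᵢ`. -/
def IsPath : V → List E → Prop
  | _, [] => True
  | v, e :: l => Γ.r e = v ∧ IsPath (Γ.s e) l

/-- The source of the path with range `v` and edges `e₁, …, eₙ`, namely `s eₙ`
(and `v` for the path of length `0` at `v`). -/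
def endpoint : V → List E → V
  | v, [] => v
  | _, e :: l => endpoint (Γ.s e) l

/-- Elements of the path space `E^*`, including the vertices as paths of length `0`. -/
@[ext] structure Path where
  /-- the range of the path -/
  r : V
  /-- the edges of the path -/
  edges : List E
  isPath : Γ.IsPath r edges

variable {Γ}

/-- The source of a path. -/
def Path.s (μ : Γ.Path) : V := Γ.endpoint μ.r μ.edges

/-- The length of a path. -/
def Path.length (μ : Γ.Path) : ℕ := μ.edges.length

variable (Γ)

/-- The set `v E^*` of paths with range `v`. -/
abbrev PathFrom (v : V) : Type u := {μ : Γ.Path // μ.r = v}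

/-- The path of length `0` at `v`. -/
def vertexPath (v : V) : Γ.PathFrom v := ⟨⟨v, [], trivial⟩, rfl⟩

/-- The edge `e` as a path of length `1`. -/
def edgePath (e : E) : Γ.PathFrom (Γ.r e) := ⟨⟨Γ.r e, [e], rfl, trivial⟩, rfl⟩

theorem isPath_append {v : V} {l l' : List E} (h : Γ.IsPath v l)
    (h' : Γ.IsPath (Γ.endpoint v l) l') : Γ.IsPath v (l ++ l') := by
  induction l generalizing v with
  | nil => exact h'
  | cons e l ih => exact ⟨h.1, ih h.2 h'⟩

variable {Γ}

/-- The concatenation `μν` of `μ ∈ v E^*` and `ν ∈ s(μ) E^*`. -/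
def PathFrom.append {v : V} (μ : Γ.PathFrom v) (ν : Γ.PathFrom μ.1.s) : Γ.PathFrom v :=
  ⟨⟨μ.1.r, μ.1.edges ++ ν.1.edges, Γ.isPath_append μ.1.isPath (by
    have := ν.1.isPath; rwa [ν.2] at this)⟩, μ.2⟩

/-- The path `μe`, for `μ ∈ v E^*` and an edge `e` with `r(e) = s(μ)`. -/
def PathFrom.snoc {v : V} (μ : Γ.PathFrom v) (e : E) (he : Γ.r e = μ.1.s) : Γ.PathFrom v :=
  μ.append ⟨(Γ.edgePath e).1, he⟩

variable (Γ)

/-- The set `E^n` of paths of length `n`. -/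
abbrev PathLen (n : ℕ) : Type u := {μ : Γ.Path // μ.length = n}

instance [Finite V] [Finite E] (n : ℕ) : Finite (Γ.PathLen n) := by
  refine Finite.of_injective
    (fun μ : Γ.PathLen n => ((μ.1.r, ⟨μ.1.edges, μ.2⟩) : V × List.Vector E n)) ?_
  rintro ⟨⟨v, l, h⟩, hl⟩ ⟨⟨v', l', h'⟩, hl'⟩ heq
  have h1 : v = v' := congrArg Prod.fst heq
  have h2 : l = l' := congrArg (fun x => x.2.1) heq
  subst h1 h2
  rfl

noncomputable instance [Finite V] [Finite E] (n : ℕ) : Fintype (Γ.PathLen n) :=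
  Fintype.ofFinite _

/-- The adjacency matrix, `A_E(v, w) = |v E^1 w|`, as a complex matrix. -/
noncomputable def adjMatrix : Matrix V V ℂ :=
  fun v w => (Nat.card {e : E // Γ.r e = v ∧ Γ.s e = w} : ℂ)

open Classical in
/-- The spectral radius `ρ(A_E)` of the adjacency matrix, as an extended nonnegative real. -/
noncomputable def rho [Fintype V] : ℝ≥0∞ := spectralRadius ℂ Γ.adjMatrix

/-- `E` is strongly connected: `v E^* w` is nonempty for all vertices `v`, `w`. -/
def StronglyConnected : Prop := ∀ v w : V, ∃ μ : Γ.PathFrom v, μ.1.s = w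

/-- A partial isomorphism of the forest `T_E` from `v` to `w`: a bijection
`v E^* → w E^*` that preserves the length of paths and sends `μe` to a path in `g(μ) E^1`. -/
structure PIso (v w : V) where
  toEquiv : Γ.PathFrom v ≃ Γ.PathFrom w
  length_map : ∀ μ, (toEquiv μ).1.length = μ.1.length
  map_snoc : ∀ (μ : Γ.PathFrom v) (e : E) (he : Γ.r e = μ.1.s),
    ∃ (f : E) (hf : Γ.r f = (toEquiv μ).1.s), toEquiv (μ.snoc e he) = (toEquiv μ).snoc f hf

end DirGraph

/-- A faithful self-similar action of a groupoid, with unit space the vertex set `V`, on the path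
forest of the directed graph `Γ`.  An arrow `g : v ⟶ w` has domain `d(g) = v` and
terminus `t(g) = w`, and the product `hg` of the groupoid is `g ≫ h`. -/
structure SelfSimilarAction {V E : Type u} (Γ : DirGraph V E) [Groupoid.{u} V] where
  /-- the partial isomorphism `μ ↦ g · μ` -/
  act : ∀ {v w : V}, (v ⟶ w) → Γ.PIso v w
  act_id : ∀ (v : V) (μ : Γ.PathFrom v), (act (𝟙 v)).toEquiv μ = μ
  act_comp : ∀ {v w x : V} (g : v ⟶ w) (h : w ⟶ x) (μ : Γ.PathFrom v),
    (act (g ≫ h)).toEquiv μ = (act h).toEquiv ((act g).toEquiv μ)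
  faithful : ∀ {v w : V} (g h : v ⟶ w),
    (∀ μ, (act g).toEquiv μ = (act h).toEquiv μ) → g = h
  /-- self-similarity: there is `k = g|_μ` with `g · (μν) = (g · μ)(k · ν)` for `ν ∈ s(μ) E^*` -/
  exists_restriction : ∀ {v w : V} (g : v ⟶ w) (μ : Γ.PathFrom v),
    ∃ k : μ.1.s ⟶ ((act g).toEquiv μ).1.s, ∀ ν : Γ.PathFrom μ.1.s,
      (act g).toEquiv (μ.append ν) = ((act g).toEquiv μ).append ((act k).toEquiv ν)

/-! ### States and traces -/

/-- A state of a unital C*-algebra. -/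
structure CStarState (A : Type*) [CStarAlgebra A] where
  toCLM : A →L[ℂ] ℂ
  nonneg : ∀ a, 0 ≤ toCLM (star a * a)
  map_one : toCLM 1 = 1

/-- A tracial state (normalised trace) of a unital C*-algebra; `Tr(A)` is the set of these. -/
structure TracialState (A : Type*) [CStarAlgebra A] extends CStarState A where
  trace : ∀ a b, toCLM (a * b) = toCLM (b * a)

noncomputable instance (A : Type*) [CStarAlgebra A] : CoeFun (CStarState A) (fun _ => A → ℂ) :=
  ⟨fun φ => φ.toCLM⟩

noncomputable instance (A : Type*) [CStarAlgebra A] : CoeFun (TracialState A) (fun _ => A → ℂ) :=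
  ⟨fun φ => φ.toCLM⟩

/-! ### Direct sums of operator algebras -/

/-- The C*-algebra `∏_i B(H_i)` of uniformly bounded families of operators. -/
def OpFamily {ι : Type*} (H : ι → Type*) [∀ i, NormedAddCommGroup (H i)]
    [∀ i, InnerProductSpace ℂ (H i)] : Type _ :=
  lp (fun i => H i →L[ℂ] H i) ∞

namespace OpFamily

variable {ι : Type*} {H : ι → Type*} [∀ i, NormedAddCommGroup (H i)]
    [∀ i, InnerProductSpace ℂ (H i)] [∀ i, CompleteSpace (H i)] [∀ i, Nontrivial (H i)]

@[reducible] noncomputable def cstarAux : CStarAlgebra (lp (fun i => H i →L[ℂ] H i) ∞) where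

noncomputable instance : CStarAlgebra (OpFamily H) := cstarAux

/-- The family with given members. -/
def mk (f : ∀ i, H i →L[ℂ] H i) (C : ℝ) (hC : ∀ i, ‖f i‖ ≤ C) : OpFamily H :=
  ⟨f, memℓp_infty ⟨C, by rintro _ ⟨i, rfl⟩; exact hC i⟩⟩

/-- The `i`-th member of a family. -/
noncomputable def eval (i : ι) : OpFamily H →⋆ₐ[ℂ] (H i →L[ℂ] H i) where
  toFun x := x.1 i
  map_one' := rfl
  map_mul' _ _ := rfl
  map_zero' := rfl
  map_add' _ _ := rfl
  commutes' _ := rfl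
  map_star' _ := rfl

theorem ext {x y : OpFamily H} (h : ∀ i, eval i x = eval i y) : x = y :=
  lp.ext (funext h)

theorem norm_eval_le (x : OpFamily H) (i : ι) : ‖eval i x‖ ≤ ‖x‖ :=
  lp.norm_apply_le_norm ENNReal.top_ne_zero x i

theorem norm_le {x : OpFamily H} {C : ℝ} (hC : 0 ≤ C) (h : ∀ i, ‖eval i x‖ ≤ C) : ‖x‖ ≤ C :=
  lp.norm_le_of_forall_le hC h

end OpFamily

/-- The C*-subalgebra (with the unit of `A`) generated by a set. -/
def cstarGen {A : Type*} [CStarAlgebra A] (s : Set A) : StarSubalgebra ℂ A :=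
  (StarAlgebra.adjoin ℂ s).topologicalClosure

instance {A : Type*} [CStarAlgebra A] (s : Set A) : IsClosed (cstarGen s : Set A) :=
  StarSubalgebra.isClosed_topologicalClosure _

noncomputable instance {A : Type*} [CStarAlgebra A] (s : Set A) : CStarAlgebra (cstarGen s) :=
  StarSubalgebra.cstarAlgebra _

theorem subset_cstarGen {A : Type*} [CStarAlgebra A] (s : Set A) {x : A} (hx : x ∈ s) :
    x ∈ cstarGen s :=
  StarSubalgebra.le_topologicalClosure _ (StarAlgebra.subset_adjoin ℂ _ hx)

theorem cstarGen_le {A : Type*} [CStarAlgebra A] {s : Set A} {B : StarSubalgebra ℂ A}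
    (hB : IsClosed (B : Set A)) (h : s ⊆ B) : cstarGen s ≤ B :=
  StarSubalgebra.topologicalClosure_minimal (StarAlgebra.adjoin_le_iff.2 h) hB

/-- The restriction of a *-homomorphism to generated C*-subalgebras. -/
def cstarGenMap {A B : Type*} [CStarAlgebra A] [CStarAlgebra B] {s : Set A} {t : Set B}
    (f : A →⋆ₐ[ℂ] B) (h : ∀ x ∈ s, f x ∈ cstarGen t) : cstarGen s →⋆ₐ[ℂ] cstarGen t :=
  (f.comp (cstarGen s).subtype).codRestrict (cstarGen t) (by
    have hle : cstarGen s ≤ (cstarGen t).comap f :=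
      cstarGen_le (IsClosed.preimage
        (AddMonoidHomClass.continuous_of_bound f 1
          fun x => by simpa using NonUnitalStarAlgHom.norm_apply_le f x)
        (inferInstance : IsClosed (cstarGen t : Set B))) h
    exact fun x => hle x.2)

/-! ### The groupoid C*-algebra -/

/-- A representation of the (discrete) groupoid on the Hilbert space `H`:
`v_g v_h = δ_{d(g), t(h)} v_{gh}`, `v_{g⁻¹} = v_g^*`, and `∑_w v_w = 1`.
In particular every `v_g` is a partial isometry. -/
structure GroupoidRep (V : Type u) [Groupoid.{u} V] [Fintype V] (H : Type u)
    [NormedAddCommGroup H] [InnerProductSpace ℂ H] [CompleteSpace H] where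
  v : ∀ {a b : V}, (a ⟶ b) → (H →L[ℂ] H)
  mul : ∀ {a b c : V} (g : b ⟶ c) (h : a ⟶ b), v g * v h = v (h ≫ g)
  mul_eq_zero : ∀ {a b b' c : V} (g : b' ⟶ c) (h : a ⟶ b), b' ≠ b → v g * v h = 0
  inv : ∀ {a b : V} (g : a ⟶ b), v (Groupoid.inv g) = star (v g)
  sum : ∑ a : V, v (𝟙 a) = 1

/-- A representation of the groupoid on some nonzero Hilbert space. -/
structure GroupoidRep.Bundled (V : Type u) [Groupoid.{u} V] [Fintype V] where
  H : Type u
  [nacg : NormedAddCommGroup H]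
  [ips : InnerProductSpace ℂ H]
  [complete : CompleteSpace H]
  [nontriv : Nontrivial H]
  rep : GroupoidRep V H

attribute [instance] GroupoidRep.Bundled.nacg GroupoidRep.Bundled.ips
  GroupoidRep.Bundled.complete GroupoidRep.Bundled.nontriv

section GroupoidAlgebra

variable (V : Type u) [Groupoid.{u} V] [Fintype V]

/-- The C*-algebra of bounded families of operators indexed by the representations
of the groupoid; the `i`-th member of a family acts on the space of the representation `i`. -/
abbrev GroupoidRep.Ambient : Type (u + 1) :=
  OpFamily (fun i : GroupoidRep.Bundled V => i.H)

variable {V}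

theorem GroupoidRep.norm_le {H : Type u}
    [NormedAddCommGroup H] [InnerProductSpace ℂ H] [CompleteSpace H] (π : GroupoidRep V H)
    {a b : V} (g : a ⟶ b) : ‖π.v g‖ ≤ 1 := by
  have h : π.v g * star (π.v g) * π.v g = π.v g := by
    rw [← π.inv, π.mul, π.mul]; simp
  have h2 : ‖star (π.v g) * π.v g‖ = ‖π.v g‖ * ‖π.v g‖ := CStarRing.norm_star_mul_self
  have h3 : (star (π.v g) * π.v g) * (star (π.v g) * π.v g) = star (π.v g) * π.v g := by
    rw [← mul_assoc, mul_assoc (star _) (π.v g) (star _), mul_assoc (star _) _ (π.v g), h]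
  have h4 : ‖star (π.v g) * π.v g‖ = ‖star (π.v g) * π.v g‖ * ‖star (π.v g) * π.v g‖ := by
    conv_lhs => rw [← h3]
    have := CStarRing.norm_star_mul_self (x := star (π.v g) * π.v g)
    simpa using this
  rw [h2] at h4
  by_contra hlt
  push Not at hlt
  nlinarith [mul_pos (lt_trans one_pos hlt) (lt_trans one_pos hlt),
    mul_lt_mul'' hlt hlt zero_le_one zero_le_one]

/-- The universal family `(π(g))_π`. -/
noncomputable def GroupoidRep.univ {a b : V} (g : a ⟶ b) : GroupoidRep.Ambient V :=
  OpFamily.mk (fun i => i.rep.v g) 1 fun i => i.rep.norm_le g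

variable (V) in
/-- The full C*-algebra `C^*(𝒢)` of the groupoid, that is, the universal C*-algebra generated by a
representation of the groupoid, realised as the C*-algebra generated by the direct sum of all
representations on Hilbert spaces. -/
def GroupoidCStar : Type (u + 1) :=
  cstarGen {x : GroupoidRep.Ambient V | ∃ (a b : V) (g : a ⟶ b), x = GroupoidRep.univ g}

noncomputable instance : CStarAlgebra (GroupoidCStar V) :=
  inferInstanceAs (CStarAlgebra (cstarGen _))

/-- The canonical generator `u_g` of `C^*(𝒢)`. -/
noncomputable def GroupoidCStar.u {a b : V} (g : a ⟶ b) : GroupoidCStar V :=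
  ⟨GroupoidRep.univ g, subset_cstarGen _ ⟨a, b, g, rfl⟩⟩

end GroupoidAlgebra

/-! ### The Toeplitz algebra -/

namespace SelfSimilarAction

section

variable {V E : Type u} {Γ : DirGraph V E} [Groupoid.{u} V] (S : SelfSimilarAction Γ)

/-- The path `g · μ`. -/
def smul {v w : V} (g : v ⟶ w) (μ : Γ.PathFrom v) : Γ.PathFrom w := (S.act g).toEquiv μ

/-- The restriction `g|_μ`; it is unique because the action is faithful. -/
noncomputable def restrict {v w : V} (g : v ⟶ w) (μ : Γ.PathFrom v) :
    μ.1.s ⟶ (S.smul g μ).1.s :=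
  (S.exists_restriction g μ).choose

theorem smul_append {v w : V} (g : v ⟶ w) (μ : Γ.PathFrom v) (ν : Γ.PathFrom μ.1.s) :
    S.smul g (μ.append ν) = (S.smul g μ).append (S.smul (S.restrict g μ) ν) :=
  (S.exists_restriction g μ).choose_spec ν

end

variable {V E : Type u} {Γ : DirGraph V E} [Groupoid.{u} V] [Fintype V] [Fintype E]

open Classical in
/-- A Toeplitz representation `(v, q, t)` of `(𝒢, E)` on the Hilbert space `H`.  The projections
are `q_w = v_w` for `w ∈ 𝒢⁽⁰⁾ = E⁰`: by the relations for `v` these are mutually orthogonal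
projections with sum `1` and `v_g q_w = δ_{d(g), w} q_{t(g)} v_g`. -/
structure ToeplitzRep (S : SelfSimilarAction Γ) (H : Type u)
    [NormedAddCommGroup H] [InnerProductSpace ℂ H] [CompleteSpace H] extends GroupoidRep V H where
  t : E → (H →L[ℂ] H)
  /-- `t_e^* t_e = q_{s(e)}` -/
  star_mul_self : ∀ e, star (t e) * t e = v (𝟙 (Γ.s e))
  /-- `∑_{e ∈ w E¹} t_e t_e^* ≤ q_w` -/
  sum_le : ∀ w, ∑ e with Γ.r e = w, t e * star (t e) ≤ v (𝟙 w)
  /-- `v_g t_e = t_{g · e} v_{g|_e}` if `d(g) = r(e)` -/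
  mul_t : ∀ {w x : V} (g : w ⟶ x) (e : E) (he : Γ.r e = w) (f : E),
    (S.smul g ⟨(Γ.edgePath e).1, he⟩).1 = (Γ.edgePath f).1 →
      v g * t e = t f * v (S.restrict g ⟨(Γ.edgePath e).1, he⟩)
  /-- `v_g t_e = 0` if `d(g) ≠ r(e)` -/
  mul_t_eq_zero : ∀ {w x : V} (g : w ⟶ x) (e : E), Γ.r e ≠ w → v g * t e = 0

/-- A Toeplitz representation on some nonzero Hilbert space. -/
structure ToeplitzRep.Bundled (S : SelfSimilarAction Γ) where
  H : Type u
  [nacg : NormedAddCommGroup H]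
  [ips : InnerProductSpace ℂ H]
  [complete : CompleteSpace H]
  [nontriv : Nontrivial H]
  rep : S.ToeplitzRep H

attribute [instance] ToeplitzRep.Bundled.nacg ToeplitzRep.Bundled.ips
  ToeplitzRep.Bundled.complete ToeplitzRep.Bundled.nontriv

variable (S : SelfSimilarAction Γ)

/-- The C*-algebra of bounded families of operators indexed by the Toeplitz representations. -/
abbrev ToeplitzRep.Ambient : Type (u + 1) :=
  OpFamily (fun i : ToeplitzRep.Bundled S => i.H)

variable {S} in
theorem ToeplitzRep.norm_t_le {H : Type u} [NormedAddCommGroup H] [InnerProductSpace ℂ H]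
    [CompleteSpace H] (π : S.ToeplitzRep H) (e : E) : ‖π.t e‖ ≤ 1 := by
  have h1 : ‖star (π.t e) * π.t e‖ = ‖π.t e‖ * ‖π.t e‖ := CStarRing.norm_star_mul_self
  have h2 : ‖π.t e‖ * ‖π.t e‖ ≤ 1 := by
    rw [← h1, π.star_mul_self]; exact π.toGroupoidRep.norm_le _
  nlinarith [norm_nonneg (π.t e)]

/-- The family of operators `(v_g)`, over all Toeplitz representations. -/
noncomputable def ToeplitzRep.univV {a b : V} (g : a ⟶ b) : ToeplitzRep.Ambient S :=
  OpFamily.mk (fun i => i.rep.v g) 1 fun i => i.rep.toGroupoidRep.norm_le g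

/-- The family of operators `(t_e)`, over all Toeplitz representations. -/
noncomputable def ToeplitzRep.univT (e : E) : ToeplitzRep.Ambient S :=
  OpFamily.mk (fun i => i.rep.t e) 1 fun i => i.rep.norm_t_le e

/-- The Toeplitz algebra `𝒯(𝒢, E)`, that is, the universal C*-algebra generated by a Toeplitz
representation, realised as the C*-algebra generated by the direct sum of all Toeplitz
representations on Hilbert spaces. -/
def Toeplitz : Type (u + 1) :=
  cstarGen ({x : ToeplitzRep.Ambient S | ∃ (a b : V) (g : a ⟶ b), x = ToeplitzRep.univV S g} ∪
    Set.range (ToeplitzRep.univT S))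

noncomputable instance : CStarAlgebra S.Toeplitz := inferInstanceAs (CStarAlgebra (cstarGen _))

/-- The generator `u_g` of the Toeplitz algebra. -/
noncomputable def u {a b : V} (g : a ⟶ b) : S.Toeplitz :=
  ⟨ToeplitzRep.univV S g, subset_cstarGen _ (Or.inl ⟨a, b, g, rfl⟩)⟩

/-- The generator `s_e` of the Toeplitz algebra. -/
noncomputable def sEdge (e : E) : S.Toeplitz :=
  ⟨ToeplitzRep.univT S e, subset_cstarGen _ (Or.inr ⟨e, rfl⟩)⟩

/-- The element `s_μ = p_{r(μ)} s_{e₁} ⋯ s_{eₙ}` for `μ = e₁ ⋯ eₙ`; for a vertex, `s_v = p_v`. -/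
noncomputable def sPath (μ : Γ.Path) : S.Toeplitz :=
  S.u (𝟙 μ.r) * (μ.edges.map S.sEdge).prod

/-- A Toeplitz representation, seen as a representation of the groupoid. -/
def ToeplitzRep.Bundled.toGroupoid {S : SelfSimilarAction Γ} (i : ToeplitzRep.Bundled S) :
    GroupoidRep.Bundled V := ⟨i.H, i.rep.toGroupoidRep⟩

/-- The *-homomorphism between the ambient algebras given by viewing Toeplitz representations as
representations of the groupoid. -/
noncomputable def ambientHom : GroupoidRep.Ambient V →⋆ₐ[ℂ] ToeplitzRep.Ambient S where
  toFun x := OpFamily.mk (fun i => OpFamily.eval i.toGroupoid x) ‖x‖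
    fun i => OpFamily.norm_eval_le x i.toGroupoid
  map_one' := rfl
  map_mul' _ _ := rfl
  map_zero' := rfl
  map_add' _ _ := rfl
  commutes' _ := rfl
  map_star' _ := rfl

/-- The canonical unital *-homomorphism `C^*(𝒢) → 𝒯(𝒢, E)`, `u_g ↦ u_g`. -/
noncomputable def incl : GroupoidCStar V →⋆ₐ[ℂ] S.Toeplitz :=
  cstarGenMap S.ambientHom (by
    rintro _ ⟨a, b, g, rfl⟩
    exact subset_cstarGen _ (Or.inl ⟨a, b, g, rfl⟩))

theorem incl_u {a b : V} (g : a ⟶ b) : S.incl (GroupoidCStar.u g) = S.u g := rfl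

end SelfSimilarAction

/-! ### The partition function -/

section

variable {V E : Type u} (Γ : DirGraph V E) [Groupoid.{u} V] [Fintype V] [Fintype E]

/-- `Z(β, τ) = ∑_{k ≥ 0} e^{-βk} ∑_{μ ∈ E^k} τ(u_{s(μ)})`. -/
noncomputable def DirGraph.Z (β : ℝ) (τ : TracialState (GroupoidCStar V)) : ℂ :=
  ∑' k : ℕ, (Real.exp (-β * k) : ℂ) * ∑ μ : Γ.PathLen k, τ (GroupoidCStar.u (𝟙 μ.1.s))

/-- `N(β, τ) = e^β (1 - Z(β, τ)⁻¹)`. -/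
noncomputable def DirGraph.N (β : ℝ) (τ : TracialState (GroupoidCStar V)) : ℂ :=
  (Real.exp β : ℂ) * (1 - (Γ.Z β τ)⁻¹)

/-- `x` is the Perron--Frobenius eigenvector of the (irreducible) adjacency matrix `A_E`: it has
strictly positive entries, its `1`-norm is `1`, and it is an eigenvector for the eigenvalue
`ρ(A_E)`. -/
def DirGraph.IsPerronFrobeniusEigenvector {V E : Type u} (Γ : DirGraph V E) [Fintype V]
    (x : V → ℂ) : Prop :=
  (∀ v, 0 < x v) ∧ ∑ v, x v = 1 ∧ Γ.adjMatrix.mulVec x = (Γ.rho.toReal : ℂ) • x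

end

namespace SelfSimilarAction
section Psi

variable {V E : Type u} {Γ : DirGraph V E} [Groupoid.{u} V] [Fintype V] [Fintype E]
  (S : SelfSimilarAction Γ)

/-- The set of paths `μ ∈ d(g) E^n` with `g · μ = μ`. -/
def FixedPaths {v w : V} (g : v ⟶ w) (n : ℕ) : Type u :=
  {μ : Γ.PathFrom v // μ.1.length = n ∧ (S.smul g μ).1 = μ.1}

instance {v w : V} (g : v ⟶ w) (n : ℕ) : Finite (S.FixedPaths g n) :=
  Finite.of_injective (fun μ : S.FixedPaths g n => (⟨μ.1.1, μ.2.1⟩ : Γ.PathLen n))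
    fun a b h => by
      have := congrArg Subtype.val h
      exact Subtype.ext (Subtype.ext this)

noncomputable instance {v w : V} (g : v ⟶ w) (n : ℕ) : Fintype (S.FixedPaths g n) :=
  Fintype.ofFinite _

/-- `∑_{μ ∈ E^n, g · μ = μ} τ(u_{g|_μ})`. -/
noncomputable def fixedSum (τ : TracialState (GroupoidCStar V)) {v w : V} (g : v ⟶ w) (n : ℕ) :
    ℂ :=
  ∑ μ : S.FixedPaths g n, τ (GroupoidCStar.u (S.restrict g μ.1))

end Psi
end SelfSimilarAction

/-! ### Construction of the states `Ψ_{β,τ}`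

The auxiliary results up to the definition of `SelfSimilarAction.Psi` prove that there is a state
of the Toeplitz algebra that satisfies the formula for `Ψ_{β,τ}`, and that it restricts to a trace
of `C^*(𝒢)`.  For this, every representation `π` of the groupoid on `H` induces a Toeplitz
representation on a corner of `ℓ²(E^*, H)`, and `Ψ_{β,τ}` is a weighted sum of `τ` of the diagonal
matrix entries. -/

/-! ### Weighted shifts -/
section Shift

variable {P : Type*} {H : Type*} [NormedAddCommGroup H] [InnerProductSpace ℂ H]

open Classical in
/-- The vector of the Hilbert space `⊕_P H` with the single entry `x` at `l`. -/
noncomputable def vecAt (l : P) : H →L[ℂ] lp (fun _ : P => H) 2 :=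
  LinearMap.mkContinuous
    { toFun := fun x => lp.single 2 l x
      map_add' := fun x y => by simp
      map_smul' := fun c x => by simp } 1
    (fun x => by
      have := lp.norm_single (E := fun _ : P => H) (p := 2) (by norm_num) l x
      simp [this])

open Classical in
theorem vecAt_apply (l : P) (x : H) :
    vecAt l x = (lp.single 2 l x : lp (fun _ : P => H) 2) := rfl

theorem vecAt_self (l : P) (x : H) : (vecAt l x : lp (fun _ : P => H) 2) l = x := by
  classical
  rw [vecAt_apply]; convert lp.single_apply_self (E := fun _ : P => H) 2 l x

theorem vecAt_ne {l k : P} (h : k ≠ l) (x : H) : (vecAt l x : lp (fun _ : P => H) 2) k = 0 := by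
  classical
  rw [vecAt_apply]; convert lp.single_apply_ne (E := fun _ : P => H) 2 l x h

theorem vecAt_hasSum (f : lp (fun _ : P => H) 2) : HasSum (fun l => vecAt l (f l)) f := by
  classical
  have := lp.hasSum_single (E := fun _ : P => H) (p := 2) (by norm_num) f
  convert this using 2
  exact vecAt_apply _ _

theorem vecAt_ext {F : Type*} [NormedAddCommGroup F] [NormedSpace ℂ F]
    {T T' : lp (fun _ : P => H) 2 →L[ℂ] F} (h : ∀ l x, T (vecAt l x) = T' (vecAt l x)) :
    T = T' := by
  ext f
  have h1 := (vecAt_hasSum f).mapL T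
  have h2 := (vecAt_hasSum f).mapL T'
  simp only [h] at h1
  exact h1.unique h2

theorem inner_vecAt_left (l : P) (x : H) (f : lp (fun _ : P => H) 2) :
    inner ℂ (vecAt l x) f = inner ℂ x (f l) := by
  classical
  rw [vecAt_apply]; convert lp.inner_single_left l x f

theorem inner_vecAt_self (l : P) (x y : H) :
    inner ℂ (vecAt l x : lp (fun _ : P => H) 2) (vecAt l y) = inner ℂ x y := by
  rw [inner_vecAt_left, vecAt_self]

theorem inner_vecAt_ne {l k : P} (h : l ≠ k) (x y : H) :
    inner ℂ (vecAt l x : lp (fun _ : P => H) 2) (vecAt k y) = 0 := by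
  rw [inner_vecAt_left, vecAt_ne h, inner_zero_right]

theorem exists_shift (c : P → Option P)
    (hc : ∀ l l' k, c l = some k → c l' = some k → l = l') (B : P → (H →L[ℂ] H))
    (hB : ∀ l, ‖B l‖ ≤ 1) :
    ∃ W : lp (fun _ : P => H) 2 →L[ℂ] lp (fun _ : P => H) 2,
      (∀ l k x, c l = some k → W (vecAt l x) = vecAt k (B l x)) ∧
      (∀ l x, c l = none → W (vecAt l x) = 0) := by
  classical
  let w : (P → H) → P → H := fun f k =>
    if h : ∃ l, c l = some k then B h.choose (f h.choose) else 0
  have key : ∀ (f : lp (fun _ : P => H) 2) (s : Finset P),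
      ∑ k ∈ s, ‖w f k‖ ^ (2 : ℝ≥0∞).toReal ≤ ‖f‖ ^ (2 : ℝ≥0∞).toReal := by
    intro f s
    let inv : P → P := fun k => if h : ∃ l, c l = some k then h.choose else k
    have hinv : ∀ k, (∃ l, c l = some k) → c (inv k) = some k := by
      intro k h; simp only [inv, dif_pos h]; exact h.choose_spec
    calc ∑ k ∈ s, ‖w f k‖ ^ (2 : ℝ≥0∞).toReal
        = ∑ k ∈ s with ∃ l, c l = some k, ‖w f k‖ ^ (2 : ℝ≥0∞).toReal := by
          rw [Finset.sum_filter]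
          refine Finset.sum_congr rfl fun k _ => ?_
          split_ifs with h
          · rfl
          · simp [w, dif_neg h]
      _ ≤ ∑ k ∈ s with ∃ l, c l = some k, ‖f (inv k)‖ ^ (2 : ℝ≥0∞).toReal := by
          refine Finset.sum_le_sum fun k hk => ?_
          have h := (Finset.mem_filter.1 hk).2
          refine Real.rpow_le_rpow (norm_nonneg _) ?_ (by simp)
          simp only [w, inv, dif_pos h]
          calc _ ≤ ‖B h.choose‖ * ‖f h.choose‖ := (B _).le_opNorm _
            _ ≤ 1 * ‖f h.choose‖ := by gcongr; exact hB _
            _ = _ := one_mul _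
      _ = ∑ l ∈ ({k ∈ s | ∃ l, c l = some k}.image inv), ‖f l‖ ^ (2 : ℝ≥0∞).toReal := by
          rw [Finset.sum_image]
          intro k hk k' hk' h
          have h1 := hinv k (Finset.mem_filter.1 hk).2
          have h2 := hinv k' (Finset.mem_filter.1 hk').2
          rw [h, h2] at h1
          exact (Option.some.inj h1).symm
      _ ≤ _ := lp.sum_rpow_le_norm_rpow (by simp) f _
  have hmem : ∀ f : lp (fun _ : P => H) 2, Memℓp (w f) 2 := fun f => memℓp_gen' (key f)
  let W0 : lp (fun _ : P => H) 2 →ₗ[ℂ] lp (fun _ : P => H) 2 :=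
    { toFun := fun f => ⟨w f, hmem f⟩
      map_add' := by
        intro f g; ext k
        simp only [w, lp.coeFn_add, Pi.add_apply]
        split_ifs <;> simp
      map_smul' := by
        intro a f; ext k
        simp only [w, lp.coeFn_smul, Pi.smul_apply, RingHom.id_apply]
        split_ifs <;> simp }
  refine ⟨W0.mkContinuous 1 fun f => ?_, ?_, ?_⟩
  · rw [one_mul]
    exact lp.norm_le_of_forall_sum_le (by simp) (norm_nonneg _) (key f)
  · intro l k x hlk
    ext k'
    change w (vecAt l x : lp (fun _ : P => H) 2) k' = _
    simp only [w]
    split_ifs with h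
    · have h1 := h.choose_spec
      by_cases hk : k' = k
      · subst hk
        rw [hc _ _ _ h1 hlk, vecAt_self, vecAt_self]
      · rw [vecAt_ne hk, vecAt_ne, map_zero]
        intro h2
        rw [h2, hlk] at h1
        exact hk (Option.some.inj h1).symm
    · rw [vecAt_ne]
      rintro rfl
      exact h ⟨l, hlk⟩
  · intro l x hl
    ext k'
    change w (vecAt l x : lp (fun _ : P => H) 2) k' = _
    simp only [w]
    split_ifs with h
    · have h1 := h.choose_spec
      rw [vecAt_ne, map_zero]; rfl
      intro h2
      rw [h2, hl] at h1
      cases h1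
    · rfl

theorem eq_star_of_vecAt [CompleteSpace H] {T T' : lp (fun _ : P => H) 2 →L[ℂ] lp (fun _ : P => H) 2}
    (h : ∀ l k x y, inner ℂ (T (vecAt l x)) (vecAt k y) = inner ℂ (vecAt l x) (T' (vecAt k y))) :
    T' = star T := by
  refine vecAt_ext fun k y => ?_
  refine ext_inner_left ℂ fun f => ?_
  rw [ContinuousLinearMap.star_eq_adjoint, ContinuousLinearMap.adjoint_inner_right]
  have h1 : (innerSL ℂ (T' (vecAt k y)) : lp (fun _ : P => H) 2 →L[ℂ] ℂ)
      = (innerSL ℂ (vecAt k y)).comp T := by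
    refine vecAt_ext fun l x => ?_
    simp only [innerSL_apply_apply, ContinuousLinearMap.comp_apply]
    rw [← inner_conj_symm, ← h, inner_conj_symm]
  have h2 := congrArg (fun φ => φ f) h1
  simp only [innerSL_apply_apply, ContinuousLinearMap.comp_apply] at h2
  rw [← inner_conj_symm, h2, inner_conj_symm]

end Shift

section Compress

variable {L : Type*} [NormedAddCommGroup L] [InnerProductSpace ℂ L] [CompleteSpace L]

/-- compression -/
theorem exists_compress (Q : L →L[ℂ] L) (h1 : Q * Q = Q) (h2 : star Q = Q) :
    ∃ (K : Submodule ℂ L) (_ : CompleteSpace K) (J : K →L[ℂ] L),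
      J ∘L (ContinuousLinearMap.adjoint J) = Q ∧ (ContinuousLinearMap.adjoint J) ∘L J = 1 := by
  have hQ : IsStarProjection Q := ⟨h1, h2⟩
  obtain ⟨K, hK, rfl⟩ := isStarProjection_iff_eq_starProjection.1 hQ
  have hc : CompleteSpace K := by
    have : IsClosed (K : Set L) := by
      have h : (K : Set L) = {x | K.starProjection x = x} := by
        ext x; exact Submodule.starProjection_eq_self_iff.symm
      rw [h]
      exact isClosed_eq K.starProjection.continuous continuous_id
    exact this.completeSpace_coe
  refine ⟨K, hc, K.subtypeL, ?_, ?_⟩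
  · rw [Submodule.adjoint_subtypeL]; rfl
  · rw [Submodule.adjoint_subtypeL]
    ext x
    simp
end Compress

namespace DirGraph
variable {V E : Type u} {Γ : DirGraph V E}

theorem PathFrom.ext {v : V} {μ ν : Γ.PathFrom v} (h : μ.1.edges = ν.1.edges) : μ = ν :=
  Subtype.ext (Path.ext (μ.2.trans ν.2.symm) h)

theorem endpoint_append (v : V) (l l' : List E) :
    Γ.endpoint v (l ++ l') = Γ.endpoint (Γ.endpoint v l) l' := by
  induction l generalizing v with
  | nil => rfl
  | cons e l ih => exact ih _

theorem PathFrom.append_s {v : V} (μ : Γ.PathFrom v) (ν : Γ.PathFrom μ.1.s) :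
    (μ.append ν).1.s = ν.1.s := by
  simp only [PathFrom.append, Path.s]
  rw [endpoint_append]
  congr 1
  exact ν.2.symm

theorem PathFrom.append_edges {v : V} (μ : Γ.PathFrom v) (ν : Γ.PathFrom μ.1.s) :
    (μ.append ν).1.edges = μ.1.edges ++ ν.1.edges := rfl

end DirGraph

namespace SelfSimilarAction

section ConsPath

variable {V E : Type u} {Γ : DirGraph V E}

/-- The path `el`. -/
def consPath (e : E) (l : Γ.Path) (h : l.r = Γ.s e) : Γ.Path :=
  ((Γ.edgePath e).append ⟨l, h⟩).1

theorem consPath_edges (e : E) (l : Γ.Path) (h : l.r = Γ.s e) :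
    (consPath e l h).edges = e :: l.edges := rfl

theorem consPath_r (e : E) (l : Γ.Path) (h : l.r = Γ.s e) :
    (consPath e l h).r = Γ.r e := rfl

theorem consPath_s (e : E) (l : Γ.Path) (h : l.r = Γ.s e) : (consPath e l h).s = l.s :=
  DirGraph.PathFrom.append_s _ _

theorem consPath_inj {e e' : E} {l l' : Γ.Path} {h : l.r = Γ.s e} {h' : l'.r = Γ.s e'}
    (H : consPath e l h = consPath e' l' h') : e = e' ∧ l = l' := by
  have h1 := congrArg (fun x => x.edges) H
  simp only [consPath_edges, List.cons.injEq] at h1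
  obtain ⟨rfl, h2⟩ := h1
  exact ⟨rfl, DirGraph.Path.ext (h.trans h'.symm) h2⟩

end ConsPath

section

variable {V E : Type u} {Γ : DirGraph V E} [Groupoid.{u} V] (S : SelfSimilarAction Γ)

/-- An arrow, with its domain and terminus. -/
def arr {a b : V} (g : a ⟶ b) : Σ a b : V, (a ⟶ b) := ⟨a, b, g⟩

theorem smul_id {v : V} (μ : Γ.PathFrom v) : S.smul (𝟙 v) μ = μ := S.act_id v μ

theorem smul_comp {v w x : V} (g : v ⟶ w) (h : w ⟶ x) (μ : Γ.PathFrom v) :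
    S.smul (g ≫ h) μ = S.smul h (S.smul g μ) := S.act_comp g h μ

theorem smul_length {v w : V} (g : v ⟶ w) (μ : Γ.PathFrom v) :
    (S.smul g μ).1.length = μ.1.length := (S.act g).length_map μ

theorem smul_injective {v w : V} (g : v ⟶ w) : Function.Injective (S.smul g) :=
  (S.act g).toEquiv.injective

theorem inv_smul_smul {v w : V} (g : v ⟶ w) (μ : Γ.PathFrom v) :
    S.smul (Groupoid.inv g) (S.smul g μ) = μ := by
  rw [← smul_comp, Groupoid.comp_inv, smul_id]

theorem smul_inv_smul {v w : V} (g : v ⟶ w) (μ : Γ.PathFrom w) :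
    S.smul g (S.smul (Groupoid.inv g) μ) = μ := by
  rw [← smul_comp, Groupoid.inv_comp, smul_id]

theorem arr_eq_restrict {v w : V} (g : v ⟶ w) (μ : Γ.PathFrom v) {a b : V} (k : a ⟶ b)
    (ha : a = μ.1.s) (hb : b = (S.smul g μ).1.s)
    (h : ∀ ν : Γ.PathFrom a, (S.smul g (μ.append ⟨ν.1, ν.2.trans ha⟩)).1.edges =
      (S.smul g μ).1.edges ++ (S.smul k ν).1.edges) :
    arr (S.restrict g μ) = arr k := by
  subst ha hb
  congr 1
  refine S.faithful _ _ fun ν => ?_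
  refine DirGraph.PathFrom.ext ?_
  have h1 := h ν
  have h2 := congrArg (fun x => x.1.edges) (S.smul_append g μ ν)
  simp only [DirGraph.PathFrom.append_edges] at h2
  exact List.append_cancel_left (h2.symm.trans h1)

theorem arr_restrict_id {v : V} (μ : Γ.PathFrom v) :
    arr (S.restrict (𝟙 v) μ) = arr (𝟙 μ.1.s) := by
  refine S.arr_eq_restrict _ _ _ rfl (by rw [smul_id]) fun ν => ?_
  rw [smul_id, smul_id, smul_id]; rfl

theorem arr_restrict_comp {v w x : V} (g : v ⟶ w) (h : w ⟶ x) (μ : Γ.PathFrom v) :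
    arr (S.restrict (g ≫ h) μ) = arr (S.restrict g μ ≫ S.restrict h (S.smul g μ)) := by
  refine S.arr_eq_restrict _ _ _ rfl (by rw [smul_comp]) fun ν => ?_
  rw [smul_comp, smul_comp, smul_comp]
  exact congrArg (fun x => x.1.edges) ((congrArg (S.smul h) (S.smul_append g μ ν)).trans
    (S.smul_append h _ _))

theorem arr_restrict_append {v w : V} (g : v ⟶ w) (μ : Γ.PathFrom v) (ν : Γ.PathFrom μ.1.s) :
    arr (S.restrict g (μ.append ν)) = arr (S.restrict (S.restrict g μ) ν) := by
  refine S.arr_eq_restrict _ _ _ (DirGraph.PathFrom.append_s μ ν).symm ?_ fun ξ => ?_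
  · rw [smul_append, DirGraph.PathFrom.append_s]
  · have h1 : (μ.append ν).append ⟨ξ.1, ξ.2.trans (DirGraph.PathFrom.append_s μ ν).symm⟩
        = μ.append (ν.append ξ) := by
      refine DirGraph.PathFrom.ext ?_
      simp [DirGraph.PathFrom.append_edges]
    rw [h1, smul_append, smul_append, smul_append]
    simp [DirGraph.PathFrom.append_edges]

theorem arr_restrict_inv {v w : V} (g : v ⟶ w) (μ : Γ.PathFrom v) :
    arr (S.restrict (Groupoid.inv g) (S.smul g μ)) = arr (Groupoid.inv (S.restrict g μ)) := by
  have key : ∀ {a b c : V} (p : a ⟶ b) (q : b ⟶ c), arr (p ≫ q) = arr (𝟙 a) →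
      arr q = arr (Groupoid.inv p) := by
    intro a b c p q h
    have hc : c = a := by
      have := congrArg (fun x => x.2.1) h
      exact this
    subst hc
    have h2 : p ≫ q = 𝟙 c := by simpa [arr] using h
    have : q = Groupoid.inv p := by
      rw [← Category.id_comp q, ← Groupoid.inv_comp p, Category.assoc, h2, Category.comp_id]
    rw [this]
  apply key
  rw [← arr_restrict_comp, ← arr_restrict_id]
  rw [Groupoid.comp_inv]

end

section Fock

variable {V E : Type u} {Γ : DirGraph V E} [Groupoid.{u} V] [Fintype V]
  (S : SelfSimilarAction Γ)
variable {H : Type u} [NormedAddCommGroup H] [InnerProductSpace ℂ H] [CompleteSpace H]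
  (π : GroupoidRep V H)

theorem _root_.GroupoidRep.v_congr {a b c d : V} {g : a ⟶ b} {h : c ⟶ d} (H : arr g = arr h) :
    π.v g = π.v h := by
  have hac : a = c := congrArg (fun x => x.1) H
  subst hac
  have hbd : b = d := by simp only [arr, Sigma.mk.injEq, heq_eq_eq, true_and] at H; exact H.1
  subst hbd
  have : g = h := by simpa [arr] using H
  rw [this]

theorem exists_fockU {v w : V} (g : v ⟶ w) :
    ∃ W : lp (fun _ : Γ.Path => H) 2 →L[ℂ] lp (fun _ : Γ.Path => H) 2,
      (∀ (l : Γ.Path) x (h : l.r = v),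
        W (vecAt l x) = vecAt (S.smul g ⟨l, h⟩).1 (π.v (S.restrict g ⟨l, h⟩) x)) ∧
      (∀ (l : Γ.Path) x, l.r ≠ v → W (vecAt l x) = 0) := by
  classical
  obtain ⟨W, h1, h2⟩ := exists_shift (H := H)
    (fun l : Γ.Path => if h : l.r = v then some (S.smul g ⟨l, h⟩).1 else none)
    (by
      intro l l' k hl hl'
      split_ifs at hl hl' with a b
      have := S.smul_injective g (Subtype.ext ((Option.some.inj hl).trans (Option.some.inj hl').symm))
      exact congrArg Subtype.val this)
    (fun l => if h : l.r = v then π.v (S.restrict g ⟨l, h⟩) else 0)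
    (by
      intro l
      split_ifs
      · exact π.norm_le _
      · simp)
  refine ⟨W, fun l x h => ?_, fun l x h => h2 l x (by simp [h])⟩
  rw [h1 l _ x (dif_pos h), dif_pos h]

theorem exists_fockT (e : E) :
    ∃ W : lp (fun _ : Γ.Path => H) 2 →L[ℂ] lp (fun _ : Γ.Path => H) 2,
      (∀ (l : Γ.Path) x (h : l.r = Γ.s e),
        W (vecAt l x) = vecAt (consPath e l h) (π.v (𝟙 l.s) x)) ∧
      (∀ (l : Γ.Path) x, l.r ≠ Γ.s e → W (vecAt l x) = 0) := by
  classical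
  obtain ⟨W, h1, h2⟩ := exists_shift (H := H)
    (fun l : Γ.Path => if h : l.r = Γ.s e then some (consPath e l h) else none)
    (by
      intro l l' k hl hl'
      split_ifs at hl hl' with a b
      exact (consPath_inj ((Option.some.inj hl).trans (Option.some.inj hl').symm)).2)
    (fun l => π.v (𝟙 l.s)) (fun l => π.norm_le _)
  refine ⟨W, fun l x h => ?_, fun l x h => h2 l x (by simp [h])⟩
  rw [h1 l _ x (dif_pos h)]

theorem exists_fockTd (e : E) :
    ∃ W : lp (fun _ : Γ.Path => H) 2 →L[ℂ] lp (fun _ : Γ.Path => H) 2,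
      (∀ (l : Γ.Path) x (h : l.r = Γ.s e),
        W (vecAt (consPath e l h) x) = vecAt l (π.v (𝟙 l.s) x)) ∧
      (∀ (k : Γ.Path) x, (∀ (l : Γ.Path) (h : l.r = Γ.s e), k ≠ consPath e l h) →
        W (vecAt k x) = 0) := by
  classical
  obtain ⟨W, h1, h2⟩ := exists_shift (H := H)
    (fun k : Γ.Path => if h : ∃ (l : Γ.Path) (h : l.r = Γ.s e), k = consPath e l h
      then some h.choose else none)
    (by
      intro l l' k hl hl'
      split_ifs at hl hl' with a b
      obtain ⟨ha, ha'⟩ := a.choose_spec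
      obtain ⟨hb, hb'⟩ := b.choose_spec
      rw [ha', hb']
      have : a.choose = b.choose := (Option.some.inj hl).trans (Option.some.inj hl').symm
      congr 1)
    (fun l => π.v (𝟙 l.s)) (fun l => π.norm_le _)
  refine ⟨W, fun l x h => ?_, fun k x h => h2 k x (dif_neg ?_)⟩
  · have hex : ∃ (l' : Γ.Path) (h' : l'.r = Γ.s e), consPath e l h = consPath e l' h' := ⟨l, h, rfl⟩
    rw [h1 _ hex.choose x (dif_pos hex), consPath_s]
    rw [← (consPath_inj hex.choose_spec.choose_spec).2]
  · rintro ⟨l, hl, hk⟩; exact h l hl hk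

theorem exists_vertex_split (x : H) : x = ∑ a : V, π.v (𝟙 a) x := by
  have := congrArg (fun T => T x) π.sum
  simpa [sum_apply] using this.symm

end Fock
end SelfSimilarAction

namespace SelfSimilarAction
section Fock

variable {V E : Type u} {Γ : DirGraph V E} [Groupoid.{u} V] [Fintype V] [Fintype E]
  (S : SelfSimilarAction Γ)

theorem _root_.GroupoidRep.id_apply {H : Type u} [NormedAddCommGroup H] [InnerProductSpace ℂ H]
    [CompleteSpace H] (π : GroupoidRep V H) {a b : V} (g : a ⟶ b) (x : H) :
    π.v (𝟙 b) (π.v g x) = π.v g x := by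
  have := congrArg (fun T => T x) (π.mul (𝟙 b) g)
  simpa using this

theorem _root_.GroupoidRep.apply_id {H : Type u} [NormedAddCommGroup H] [InnerProductSpace ℂ H]
    [CompleteSpace H] (π : GroupoidRep V H) {a b : V} (g : a ⟶ b) (x : H) :
    π.v g (π.v (𝟙 a) x) = π.v g x := by
  have := congrArg (fun T => T x) (π.mul g (𝟙 a))
  simpa using this

theorem _root_.GroupoidRep.star_id {H : Type u} [NormedAddCommGroup H] [InnerProductSpace ℂ H]
    [CompleteSpace H] (π : GroupoidRep V H) (a : V) : star (π.v (𝟙 a)) = π.v (𝟙 a) := by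
  rw [← π.inv]; congr 1
  rw [← Category.id_comp (Groupoid.inv (𝟙 a)), Groupoid.comp_inv]

theorem _root_.GroupoidRep.inner_v {H : Type u} [NormedAddCommGroup H] [InnerProductSpace ℂ H]
    [CompleteSpace H] (π : GroupoidRep V H) {a b : V} (g : a ⟶ b) (x y : H) :
    inner ℂ (π.v g x) y = inner ℂ x (π.v (Groupoid.inv g) y) := by
  rw [π.inv, ContinuousLinearMap.star_eq_adjoint, ContinuousLinearMap.adjoint_inner_right]

theorem clm_mul_apply {L : Type*} [NormedAddCommGroup L] [InnerProductSpace ℂ L]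
    (A B : L →L[ℂ] L) (x : L) : (A * B) x = A (B x) := rfl

theorem vecAt_congr {P H : Type*} [NormedAddCommGroup H] [InnerProductSpace ℂ H] {l k : P}
    {x y : H} (h : l = k) (h' : x = y) :
    (vecAt l x : lp (fun _ : P => H) 2) = vecAt k y := by rw [h, h']

theorem path_cases (k : Γ.Path) :
    k.edges = [] ∨ ∃ (e : E) (l : Γ.Path) (h : l.r = Γ.s e), k = consPath e l h := by
  obtain ⟨r, edges, hp⟩ := k
  cases edges with
  | nil => exact Or.inl rfl
  | cons e l =>
    refine Or.inr ⟨e, ⟨Γ.s e, l, hp.2⟩, rfl, ?_⟩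
    exact DirGraph.Path.ext hp.1.symm rfl

variable {H : Type u} [NormedAddCommGroup H] [InnerProductSpace ℂ H] [CompleteSpace H]

open Classical in
theorem exists_fockL (π : GroupoidRep V H) :
    ∃ (U : ∀ a b : V, (a ⟶ b) → (lp (fun _ : Γ.Path => H) 2 →L[ℂ] lp (fun _ : Γ.Path => H) 2))
      (T : E → (lp (fun _ : Γ.Path => H) 2 →L[ℂ] lp (fun _ : Γ.Path => H) 2))
      (Q : lp (fun _ : Γ.Path => H) 2 →L[ℂ] lp (fun _ : Γ.Path => H) 2),
      (∀ (v w : V) (g : v ⟶ w) (l : Γ.Path) x (h : l.r = v),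
        U _ _ g (vecAt l x) = vecAt (S.smul g ⟨l, h⟩).1 (π.v (S.restrict g ⟨l, h⟩) x)) ∧
      (∀ (v w : V) (g : v ⟶ w) (l : Γ.Path) x, l.r ≠ v → U _ _ g (vecAt l x) = 0) ∧
      (∀ (e : E) (l : Γ.Path) x (h : l.r = Γ.s e),
        T e (vecAt l x) = vecAt (consPath e l h) (π.v (𝟙 l.s) x)) ∧
      (∀ (e : E) (l : Γ.Path) x, l.r ≠ Γ.s e → T e (vecAt l x) = 0) ∧
      (∀ (e : E) (l : Γ.Path) x (h : l.r = Γ.s e),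
        (star (T e)) (vecAt (consPath e l h) x) = vecAt l (π.v (𝟙 l.s) x)) ∧
      (∀ (e : E) (k : Γ.Path) x, (∀ (l : Γ.Path) (h : l.r = Γ.s e), k ≠ consPath e l h) →
        (star (T e)) (vecAt k x) = 0) ∧
      (∀ {a b c : V} (g : b ⟶ c) (h : a ⟶ b), U _ _ g * U _ _ h = U _ _ (h ≫ g)) ∧
      (∀ {a b b' c : V} (g : b' ⟶ c) (h : a ⟶ b), b' ≠ b → U _ _ g * U _ _ h = 0) ∧
      (∀ {a b : V} (g : a ⟶ b), U _ _ (Groupoid.inv g) = star (U _ _ g)) ∧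
      (∀ e, star (T e) * T e = U _ _ (𝟙 (Γ.s e))) ∧
      (∀ w, ∑ e with Γ.r e = w, T e * star (T e) ≤ U _ _ (𝟙 w)) ∧
      (∀ {w x : V} (g : w ⟶ x) (e : E) (he : Γ.r e = w) (f : E),
        (S.smul g ⟨(Γ.edgePath e).1, he⟩).1 = (Γ.edgePath f).1 →
          U _ _ g * T e = T f * U _ _ (S.restrict g ⟨(Γ.edgePath e).1, he⟩)) ∧
      (∀ {w x : V} (g : w ⟶ x) (e : E), Γ.r e ≠ w → U _ _ g * T e = 0) ∧
      (Q = ∑ a : V, U _ _ (𝟙 a)) ∧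
      (∀ (l : Γ.Path) x, Q (vecAt l x) = vecAt l (π.v (𝟙 l.s) x)) ∧
      Q * Q = Q ∧ star Q = Q ∧
      (∀ {a b : V} (g : a ⟶ b), Q * U _ _ g = U _ _ g) ∧
      (∀ e, Q * T e = T e) ∧ (∀ e, Q * star (T e) = star (T e)) := by
  choose U hU hU0 using fun (v w : V) (g : v ⟶ w) => S.exists_fockU π g
  choose T hT hT0 using fun e : E => exists_fockT (Γ := Γ) π e
  choose Td hTd hTd0 using fun e : E => exists_fockTd (Γ := Γ) π e
  have hUid : ∀ (a : V) (l : Γ.Path) x, l.r = a →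
      U _ _ (𝟙 a) (vecAt l x) = vecAt l (π.v (𝟙 l.s) x) := by
    intro a l x h
    rw [hU _ _ (𝟙 a) l x h]
    congr 1
    · congr 1
      exact congrArg Subtype.val (S.smul_id (⟨l, h⟩ : Γ.PathFrom a))
    · exact congrArg (fun T => T x) (π.v_congr (S.arr_restrict_id (⟨l, h⟩ : Γ.PathFrom a)))
  have hUmul : ∀ {a b c : V} (g : b ⟶ c) (h : a ⟶ b), U _ _ g * U _ _ h = U _ _ (h ≫ g) := by
    intro a b c g h
    refine vecAt_ext fun l x => ?_
    rw [clm_mul_apply]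
    by_cases hl : l.r = a
    · rw [hU _ _ h l x hl, hU _ _ g _ _ (S.smul h ⟨l, hl⟩).2, hU _ _ (h ≫ g) l x hl]
      have e1 := congrArg Subtype.val (S.smul_comp h g ⟨l, hl⟩)
      have e2 := π.v_congr (S.arr_restrict_comp h g ⟨l, hl⟩)
      have e3 := congrArg (fun T => T x)
        (π.mul (S.restrict g (S.smul h ⟨l, hl⟩)) (S.restrict h ⟨l, hl⟩))
      exact vecAt_congr e1.symm (e3.trans (congrArg (fun T => T x) e2.symm))
    · rw [hU0 _ _ h l x hl, hU0 _ _ (h ≫ g) l x hl, map_zero]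
  have hUmul0 : ∀ {a b b' c : V} (g : b' ⟶ c) (h : a ⟶ b), b' ≠ b →
      U _ _ g * U _ _ h = 0 := by
    intro a b b' c g h hb
    refine vecAt_ext fun l x => ?_
    rw [clm_mul_apply, zero_apply]
    by_cases hl : l.r = a
    · rw [hU _ _ h l x hl, hU0 _ _ g]
      rw [(S.smul h ⟨l, hl⟩).2]
      exact hb.symm
    · rw [hU0 _ _ h l x hl, map_zero]
  have hUinv : ∀ {a b : V} (g : a ⟶ b), U _ _ (Groupoid.inv g) = star (U _ _ g) := by
    intro a b g
    refine eq_star_of_vecAt fun l k x y => ?_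
    by_cases hl : l.r = a
    · rw [hU _ _ g l x hl]
      by_cases hk : k.r = b
      · rw [hU _ _ (Groupoid.inv g) k y hk]
        by_cases hlk : (S.smul g ⟨l, hl⟩).1 = k
        · subst hlk
          have e1 : (S.smul (Groupoid.inv g) ⟨(S.smul g ⟨l, hl⟩).1, hk⟩).1 = l :=
            congrArg Subtype.val (S.inv_smul_smul g ⟨l, hl⟩)
          refine (inner_vecAt_self _ _ _).trans (Eq.trans ?_ (congrArg (inner ℂ (vecAt l x))
            (vecAt_congr e1.symm rfl)))
          rw [inner_vecAt_self, π.inner_v]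
          congr 1
          exact congrArg (fun T => T y) (π.v_congr (S.arr_restrict_inv g ⟨l, hl⟩).symm)
        · rw [inner_vecAt_ne hlk, inner_vecAt_ne]
          intro h
          apply hlk
          have e1 : (⟨l, hl⟩ : Γ.PathFrom a) = S.smul (Groupoid.inv g) ⟨k, hk⟩ := Subtype.ext h
          rw [e1, S.smul_inv_smul]
      · rw [hU0 _ _ (Groupoid.inv g) k y hk, inner_zero_right, inner_vecAt_ne]
        rintro rfl
        exact hk (S.smul g ⟨l, hl⟩).2
    · rw [hU0 _ _ g l x hl, inner_zero_left]
      by_cases hk : k.r = b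
      · rw [hU _ _ (Groupoid.inv g) k y hk, inner_vecAt_ne]
        rintro rfl
        exact hl (S.smul (Groupoid.inv g) ⟨k, hk⟩).2
      · rw [hU0 _ _ (Groupoid.inv g) k y hk, inner_zero_right]
  have hTstar : ∀ e, Td e = star (T e) := by
    intro e
    refine eq_star_of_vecAt fun l k x y => ?_
    by_cases hl : l.r = Γ.s e
    · rw [hT e l x hl]
      by_cases hk : ∃ (l' : Γ.Path) (h' : l'.r = Γ.s e), k = consPath e l' h'
      · obtain ⟨l', h', rfl⟩ := hk
        rw [hTd e l' y h']
        by_cases hll : l = l'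
        · subst hll
          rw [inner_vecAt_self, inner_vecAt_self, π.inner_v, π.inv, π.star_id]
        · rw [inner_vecAt_ne hll, inner_vecAt_ne]
          intro h; exact hll (consPath_inj h).2
      · rw [hTd0 e k y fun l' h' h => hk ⟨l', h', h⟩, inner_zero_right, inner_vecAt_ne]
        rintro rfl
        exact hk ⟨l, hl, rfl⟩
    · rw [hT0 e l x hl, inner_zero_left]
      by_cases hk : ∃ (l' : Γ.Path) (h' : l'.r = Γ.s e), k = consPath e l' h'
      · obtain ⟨l', h', rfl⟩ := hk
        rw [hTd e l' y h', inner_vecAt_ne]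
        rintro rfl; exact hl h'
      · rw [hTd0 e k y fun l' h' h => hk ⟨l', h', h⟩, inner_zero_right]
  have hTT : ∀ e, star (T e) * T e = U _ _ (𝟙 (Γ.s e)) := by
    intro e
    rw [← hTstar]
    refine vecAt_ext fun l x => ?_
    rw [clm_mul_apply]
    by_cases hl : l.r = Γ.s e
    · rw [hT e l x hl, hTd e l _ hl, hUid _ l x hl, π.id_apply]
    · rw [hT0 e l x hl, map_zero]
      exact (hU0 _ _ (𝟙 (Γ.s e)) l x hl).symm
  have hTTd : ∀ e (l : Γ.Path) (h : l.r = Γ.s e) x, (T e * Td e) (vecAt (consPath e l h) x) =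
      vecAt (consPath e l h) (π.v (𝟙 (consPath e l h).s) x) := by
    intro e l h x
    rw [clm_mul_apply, hTd e l x h, hT e l _ h, π.id_apply, consPath_s]
  have hTTd0 : ∀ e (k : Γ.Path) x, (∀ (l : Γ.Path) (h : l.r = Γ.s e), k ≠ consPath e l h) →
      (T e * Td e) (vecAt k x) = 0 := by
    intro e k x h
    rw [clm_mul_apply, hTd0 e k x h, map_zero]
  have hle : ∀ w, ∑ e with Γ.r e = w, T e * star (T e) ≤ U _ _ (𝟙 w) := by
    intro w
    set R := U _ _ (𝟙 w) - ∑ e with Γ.r e = w, T e * star (T e) with hR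
    have hRv : ∀ k : Γ.Path, (∀ x, R (vecAt k x) = 0) ∨
        (∀ x, R (vecAt k x) = vecAt k (π.v (𝟙 k.s) x)) := by
      intro k
      by_cases hk : k.r = w
      · rcases path_cases k with h0 | ⟨e, l, h, rfl⟩
        · right
          intro x
          rw [hR, sub_apply, sum_apply, Finset.sum_eq_zero, sub_zero, hUid w k x hk]
          intro e _
          rw [← hTstar, hTTd0]
          rintro l h rfl
          rw [consPath_edges] at h0
          cases h0
        · left
          intro x
          rw [hR, sub_apply, sum_apply, Finset.sum_eq_single e, ← hTstar, hTTd, hUid w _ x hk,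
            sub_self]
          · intro e' _ hne
            rw [← hTstar, hTTd0]
            intro l' h' hh
            exact hne (consPath_inj hh).1.symm
          · intro hn
            exact absurd (Finset.mem_filter.2 ⟨Finset.mem_univ e, hk⟩) hn
      · left
        intro x
        rw [hR, sub_apply, sum_apply, Finset.sum_eq_zero, sub_zero]
        · exact hU0 _ _ (𝟙 w) k x hk
        · intro e he
          rw [← hTstar, hTTd0]
          rintro l h rfl
          exact hk (Finset.mem_filter.1 he).2
    have hRR : R * R = R := by
      refine vecAt_ext fun k x => ?_
      rw [clm_mul_apply]
      rcases hRv k with h | h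
      · rw [h, map_zero]
      · rw [h, h, π.id_apply]
    have hRs : star R = R := by
      have h1 : star (U _ _ (𝟙 w)) = U _ _ (𝟙 w) := by
        rw [← hUinv]; congr 2
        rw [← Category.id_comp (Groupoid.inv (𝟙 w)), Groupoid.comp_inv]
      rw [hR, star_sub, star_sum, h1]
      simp [star_mul]
    have : 0 ≤ R := by
      rw [← hRR]; nth_rewrite 1 [← hRs]; exact star_mul_self_nonneg R
    exact sub_nonneg.1 this
  set Q : lp (fun _ : Γ.Path => H) 2 →L[ℂ] lp (fun _ : Γ.Path => H) 2 :=
    ∑ a : V, U _ _ (𝟙 a) with hQ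
  have hQv : ∀ (l : Γ.Path) x, Q (vecAt l x) = vecAt l (π.v (𝟙 l.s) x) := by
    intro l x
    rw [hQ, sum_apply, Finset.sum_eq_single l.r, hUid _ _ _ rfl]
    · intro a _ ha
      exact hU0 _ _ (𝟙 a) l x ha.symm
    · simp
  have hUinv1 : ∀ a, star (U _ _ (𝟙 a)) = U _ _ (𝟙 a) := by
    intro a
    rw [← hUinv]; congr 1
    rw [← Category.id_comp (Groupoid.inv (𝟙 a)), Groupoid.comp_inv]
  have hQQ : Q * Q = Q := by
    refine vecAt_ext fun l x => ?_
    rw [clm_mul_apply, hQv, hQv, π.id_apply]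
  have hQs : star Q = Q := by
    rw [hQ, star_sum]; exact Finset.sum_congr rfl fun a _ => hUinv1 a
  have hQU : ∀ {a b : V} (g : a ⟶ b), Q * U _ _ g = U _ _ g := by
    intro a b g
    refine vecAt_ext fun l x => ?_
    rw [clm_mul_apply]
    by_cases hl : l.r = a
    · rw [hU _ _ g l x hl, hQv, π.id_apply]
    · rw [hU0 _ _ g l x hl, map_zero]
  have hQT : ∀ e, Q * T e = T e := by
    intro e
    refine vecAt_ext fun l x => ?_
    rw [clm_mul_apply]
    by_cases hl : l.r = Γ.s e
    · rw [hT e l x hl, hQv, consPath_s, π.id_apply]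
    · rw [hT0 e l x hl, map_zero]
  have hQTd : ∀ e, Q * star (T e) = star (T e) := by
    intro e
    rw [← hTstar]
    refine vecAt_ext fun l x => ?_
    rw [clm_mul_apply]
    by_cases hl : ∃ (l' : Γ.Path) (h' : l'.r = Γ.s e), l = consPath e l' h'
    · obtain ⟨l', h', rfl⟩ := hl
      rw [hTd e l' x h', hQv, π.id_apply]
    · rw [hTd0 e l x fun l' h' h => hl ⟨l', h', h⟩, map_zero]
  have hUT : ∀ {w x : V} (g : w ⟶ x) (e : E) (he : Γ.r e = w) (f : E),
      (S.smul g ⟨(Γ.edgePath e).1, he⟩).1 = (Γ.edgePath f).1 →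
        U _ _ g * T e = T f * U _ _ (S.restrict g ⟨(Γ.edgePath e).1, he⟩) := by
    intro w x g e he f hf
    subst he
    refine vecAt_ext fun l y => ?_
    rw [clm_mul_apply,
      clm_mul_apply]
    by_cases hl : l.r = Γ.s e
    · have hs : (S.smul g (Γ.edgePath e)).1.s = Γ.s f := by
        have := congrArg DirGraph.Path.s hf
        exact this
      have hr : (S.smul (S.restrict g (Γ.edgePath e)) ⟨l, hl⟩).1.r = Γ.s f :=
        (S.smul (S.restrict g (Γ.edgePath e)) ⟨l, hl⟩).2.trans hs
      rw [hT e l y hl, hU _ _ g (consPath e l hl) _ (consPath_r e l hl),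
        hU _ _ (S.restrict g (Γ.edgePath e)) l y hl, hT f _ _ hr, π.id_apply]
      have e1 : (S.smul g ⟨consPath e l hl, consPath_r e l hl⟩).1 =
          consPath f (S.smul (S.restrict g (Γ.edgePath e)) ⟨l, hl⟩).1 hr := by
        have h1 := S.smul_append g (Γ.edgePath e) ⟨l, hl⟩
        refine (congrArg Subtype.val h1).trans (DirGraph.Path.ext ?_ ?_)
        · have hr1 : (S.smul g (Γ.edgePath e)).1.r = Γ.r f := congrArg DirGraph.Path.r hf
          exact hr1
        · have hr1 : (S.smul g (Γ.edgePath e)).1.edges = [f] := congrArg DirGraph.Path.edges hf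
          exact congrArg (fun m => m ++ (S.smul (S.restrict g (Γ.edgePath e)) ⟨l, hl⟩).1.edges) hr1
      have e2 := π.v_congr (S.arr_restrict_append g (Γ.edgePath e) ⟨l, hl⟩)
      have e3 : π.v (S.restrict g ⟨consPath e l hl, consPath_r e l hl⟩) (π.v (𝟙 l.s) y) =
          π.v (S.restrict g ⟨consPath e l hl, consPath_r e l hl⟩) y := by
        have h := π.v_congr (congrArg (fun a => arr (𝟙 a)) (consPath_s e l hl))
        rw [← h]
        exact π.apply_id _ y
      exact vecAt_congr e1 (e3.trans (congrArg (fun T => T y) e2))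
    · rw [hT0 e l y hl, map_zero]
      have := hU0 _ _ (S.restrict g (Γ.edgePath e)) l y hl
      exact ((congrArg (T f) this).trans (map_zero _)).symm
  have hUT0 : ∀ {w x : V} (g : w ⟶ x) (e : E), Γ.r e ≠ w → U _ _ g * T e = 0 := by
    intro w x g e he
    refine vecAt_ext fun l y => ?_
    rw [clm_mul_apply]
    by_cases hl : l.r = Γ.s e
    · rw [hT e l y hl, hU0 _ _ g _ _ he]; rfl
    · rw [hT0 e l y hl, map_zero]; rfl
  refine ⟨U, T, Q, hU, hU0, hT, hT0, ?_, ?_, hUmul, hUmul0, hUinv, hTT, hle, hUT, hUT0, hQ, hQv,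
    hQQ, hQs, hQU, hQT, hQTd⟩
  · intro e l x h; rw [← hTstar]; exact hTd e l x h
  · intro e k x h; rw [← hTstar]; exact hTd0 e k x h

set_option maxHeartbeats 1000000 in
open Classical in
theorem exists_fock (i : GroupoidRep.Bundled V) :
    ∃ (F : ToeplitzRep.Bundled S) (J : Γ.Path → i.H →L[ℂ] F.H),
      (∀ {v w : V} (g : v ⟶ w) (l : Γ.Path) (h : l.r = v) x,
        F.rep.v g (J l x) = J (S.smul g ⟨l, h⟩).1 (i.rep.v (S.restrict g ⟨l, h⟩) x)) ∧
      (∀ {v w : V} (g : v ⟶ w) (l : Γ.Path) x, l.r ≠ v → F.rep.v g (J l x) = 0) ∧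
      (∀ (e : E) (l : Γ.Path) (h : l.r = Γ.s e) x, F.rep.t e (J l x) = J (consPath e l h) x) ∧
      (∀ (e : E) (l : Γ.Path) x, l.r ≠ Γ.s e → F.rep.t e (J l x) = 0) ∧
      (∀ (e : E) (l : Γ.Path) (h : l.r = Γ.s e) x,
        (star (F.rep.t e)) (J (consPath e l h) x) = J l x) ∧
      (∀ (e : E) (k : Γ.Path) x, (∀ (l : Γ.Path) (h : l.r = Γ.s e), k ≠ consPath e l h) →
        (star (F.rep.t e)) (J k x) = 0) ∧
      (∀ (l : Γ.Path) x y, inner ℂ (J l x) (J l y) = inner ℂ x (i.rep.v (𝟙 l.s) y)) ∧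
      (∀ (l k : Γ.Path) x y, l ≠ k → inner ℂ (J l x) (J k y) = 0) := by
  obtain ⟨H, π⟩ := i
  dsimp only
  obtain ⟨U, T, Q, hU, hU0, hT, hT0, hTd, hTd0, hUmul, hUmul0, hUinv, hTT, hle, hUT, hUT0, hQ,
    hQv, hQQ, hQs, hQU, hQT, hQTd⟩ := S.exists_fockL π
  obtain ⟨K, hK, J, hJ1, hJ2⟩ := exists_compress Q hQQ hQs
  set Jd := ContinuousLinearMap.adjoint J with hJd
  let C : (lp (fun _ : Γ.Path => H) 2 →L[ℂ] lp (fun _ : Γ.Path => H) 2) → (K →L[ℂ] K) :=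
    fun a => Jd ∘L a ∘L J
  have hCmul : ∀ a b, Q * b = b → C a * C b = C (a * b) := by
    intro a b hb
    ext1 y
    change Jd (a (J (Jd (b (J y))))) = Jd (a (b (J y)))
    have h1 : J (Jd (b (J y))) = Q (b (J y)) := congrArg (fun T => T (b (J y))) hJ1
    have h2 : Q (b (J y)) = b (J y) := congrArg (fun T => T (J y)) hb
    rw [h1, h2]
  have hCstar : ∀ a, star (C a) = C (star a) := by
    intro a
    simp only [C, ContinuousLinearMap.star_eq_adjoint, ContinuousLinearMap.adjoint_comp, hJd,
      ContinuousLinearMap.adjoint_adjoint]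
    rfl
  have hCsum : ∀ {ι : Type u} (s : Finset ι)
      (f : ι → (lp (fun _ : Γ.Path => H) 2 →L[ℂ] lp (fun _ : Γ.Path => H) 2)), C (∑ i ∈ s, f i) = ∑ i ∈ s, C (f i) := by
    intro ι s f
    ext1 y
    simp only [C, ContinuousLinearMap.comp_apply, sum_apply, map_sum]
  have hCle : ∀ {a b}, a ≤ b → C a ≤ C b := by
    intro a b hab
    rw [ContinuousLinearMap.le_def] at hab ⊢
    have h := hab.adjoint_conj J
    have : C b - C a = Jd ∘L (b - a) ∘L J := by
      ext1 y
      simp [C]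
    rw [this]
    exact h
  have hC0 : C 0 = 0 := by
    ext1 y; simp [C]
  have hnt : Nontrivial K := by
    obtain ⟨x, hx⟩ := exists_ne (0 : H)
    obtain ⟨a, ha⟩ : ∃ a : V, π.v (𝟙 a) x ≠ 0 := by
      by_contra hcon
      push Not at hcon
      apply hx
      rw [exists_vertex_split π x]
      exact Finset.sum_eq_zero fun a _ => hcon a
    refine nontrivial_of_ne (Jd (vecAt (Γ.vertexPath a).1 x)) 0 fun h0 => ha ?_
    have h1 : J (Jd (vecAt (Γ.vertexPath a).1 x)) = Q (vecAt (Γ.vertexPath a).1 x) :=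
      congrArg (fun T => T (vecAt (Γ.vertexPath a).1 x)) hJ1
    rw [h0, map_zero, hQv] at h1
    have h2 := congrArg (fun f : lp (fun _ : Γ.Path => H) 2 => f (Γ.vertexPath a).1) h1
    simp only [vecAt_self] at h2
    exact h2.symm
  let F : S.ToeplitzRep K :=
    { v := fun {a b} g => C (U a b g)
      mul := fun {a b c} g h => by rw [hCmul _ _ (hQU h), hUmul]
      mul_eq_zero := fun {a b b' c} g h hb => by rw [hCmul _ _ (hQU h), hUmul0 g h hb, hC0]
      inv := fun {a b} g => by rw [hUinv, hCstar]
      sum := by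
        rw [← hCsum, ← hQ]
        ext1 y
        have h1 : J (Jd (J y)) = Q (J y) := congrArg (fun T => T (J y)) hJ1
        change Jd (Q (J y)) = y
        rw [← h1]
        have h2 : ∀ z, Jd (J z) = z := fun z => congrArg (fun T => T z) hJ2
        rw [h2, h2]
      t := fun e => C (T e)
      star_mul_self := fun e => by rw [hCstar, hCmul _ _ (hQT e), hTT]
      sum_le := fun w => by
        have : ∀ e, C (T e) * star (C (T e)) = C (T e * star (T e)) := fun e => by
          rw [hCstar, hCmul _ _ (hQTd e)]
        simp only [this]
        rw [← hCsum]
        exact hCle (hle w)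
      mul_t := fun {w x} g e he f hf => by
        rw [hCmul _ _ (hQT e), hCmul _ _ (hQU _), hUT g e he f hf]
      mul_t_eq_zero := fun {w x} g e he => by rw [hCmul _ _ (hQT e), hUT0 g e he, hC0] }
  have hJJ : ∀ z, J (Jd z) = Q z := fun z => congrArg (fun T => T z) hJ1
  have hJQ : ∀ z, Jd (Q z) = Jd z := by
    intro z
    rw [← hJJ]
    exact congrArg (fun T => T (Jd z)) hJ2
  have hCv : ∀ a, a * Q = a → ∀ z, C a (Jd z) = Jd (a z) := by
    intro a ha z
    change Jd (a (J (Jd z))) = _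
    rw [hJJ]
    exact congrArg Jd (congrArg (fun T => T z) ha)
  have hUQ : ∀ {a b : V} (g : a ⟶ b), U _ _ g * Q = U _ _ g := by
    intro a b g
    have := congrArg star (hQU (Groupoid.inv g))
    rwa [star_mul, hQs, hUinv, star_star] at this
  have hTQ : ∀ e, T e * Q = T e := by
    intro e
    have := congrArg star (hQTd e)
    rwa [star_mul, hQs, star_star] at this
  have hTdQ : ∀ e, star (T e) * Q = star (T e) := by
    intro e
    have := congrArg star (hQT e)
    rwa [star_mul, hQs] at this
  have hJid : ∀ (l : Γ.Path) x, Jd (vecAt l (π.v (𝟙 l.s) x)) = Jd (vecAt l x) := by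
    intro l x; rw [← hQv, hJQ]
  have hinner : ∀ (l k : Γ.Path) x y, inner ℂ (Jd (vecAt l x)) (Jd (vecAt k y)) =
      inner ℂ (vecAt l x) (vecAt k (π.v (𝟙 k.s) y)) := by
    intro l k x y
    rw [← hQv, ← hJJ, hJd, ContinuousLinearMap.adjoint_inner_left]
  refine ⟨⟨K, F⟩, fun l => Jd ∘L vecAt l, ?_, ?_, ?_, ?_, ?_, ?_, ?_, ?_⟩
  · intro v w g l h x
    exact (hCv _ (hUQ g) _).trans (congrArg Jd (hU _ _ g l x h))
  · intro v w g l x h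
    exact (hCv _ (hUQ g) _).trans ((congrArg Jd (hU0 _ _ g l x h)).trans (map_zero _))
  · intro e l h x
    refine (hCv _ (hTQ e) _).trans ((congrArg Jd (hT e l x h)).trans ?_)
    have := hJid (consPath e l h) x
    rwa [consPath_s] at this
  · intro e l x h
    exact (hCv _ (hTQ e) _).trans ((congrArg Jd (hT0 e l x h)).trans (map_zero _))
  · intro e l h x
    change star (C (T e)) _ = _
    rw [hCstar]
    exact (hCv _ (hTdQ e) _).trans ((congrArg Jd (hTd e l x h)).trans (hJid l x))
  · intro e k x h
    change star (C (T e)) _ = _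
    rw [hCstar]
    exact (hCv _ (hTdQ e) _).trans ((congrArg Jd (hTd0 e k x h)).trans (map_zero _))
  · intro l x y
    exact (hinner l l x y).trans (inner_vecAt_self _ _ _)
  · intro l k x y h
    exact (hinner l k x y).trans (inner_vecAt_ne h _ _)


end Fock
end SelfSimilarAction

namespace DirGraph
open scoped NNReal
open Filter Topology
open SelfSimilarAction (consPath)
variable {V E : Type u} (Γ : DirGraph V E)

abbrev PathFromLen (v : V) (n : ℕ) : Type u := {μ : Γ.Path // μ.r = v ∧ μ.length = n}

instance [Finite V] [Finite E] (v : V) (n : ℕ) : Finite (Γ.PathFromLen v n) :=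
  Finite.of_injective (fun μ : Γ.PathFromLen v n => (⟨μ.1, μ.2.2⟩ : Γ.PathLen n))
    fun a b h => by
      have := congrArg Subtype.val h
      exact Subtype.ext this

noncomputable def pathSuccEquiv (v : V) (n : ℕ) :
    Γ.PathFromLen v (n + 1) ≃ Σ e : {e : E // Γ.r e = v}, Γ.PathFromLen (Γ.s e.1) n := by
  refine (Equiv.ofBijective (fun x : (Σ e : {e : E // Γ.r e = v}, Γ.PathFromLen (Γ.s e.1) n) =>
    (⟨consPath x.1.1 x.2.1 x.2.2.1, x.1.2, ?_⟩ : Γ.PathFromLen v (n + 1))) ⟨?_, ?_⟩).symm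
  · have := x.2.2.2
    simp only [Path.length] at this ⊢
    rw [SelfSimilarAction.consPath_edges, List.length_cons, this]
  · rintro ⟨⟨e, he⟩, ⟨l, hl⟩⟩ ⟨⟨e', he'⟩, ⟨l', hl'⟩⟩ h
    have h' : consPath e l hl.1 = consPath e' l' hl'.1 := congrArg Subtype.val h
    obtain ⟨rfl, rfl⟩ := SelfSimilarAction.consPath_inj h'
    rfl
  · rintro ⟨⟨r, edges, hp⟩, hr, hl⟩
    cases edges with
    | nil => simp [Path.length] at hl
    | cons e l =>
      have hn : l.length = n := by simpa [Path.length] using hl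
      refine ⟨⟨⟨e, hp.1.trans hr⟩, ⟨⟨Γ.s e, l, hp.2⟩, rfl, hn⟩⟩, ?_⟩
      refine Subtype.ext (Path.ext hp.1 rfl)

open Classical in
theorem pow_mulVec_one [Fintype V] [Fintype E] (n : ℕ) (v : V) :
    ((Γ.adjMatrix ^ n).mulVec (fun _ => 1)) v = (Nat.card (Γ.PathFromLen v n) : ℂ) := by
  induction n generalizing v with
  | zero =>
    rw [pow_zero, Matrix.one_mulVec]
    have : Nat.card (Γ.PathFromLen v 0) = 1 := by
      rw [Nat.card_eq_one_iff_unique]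
      refine ⟨⟨fun a b => ?_⟩, ⟨⟨(Γ.vertexPath v).1, rfl, rfl⟩⟩⟩
      refine Subtype.ext (Path.ext (a.2.1.trans b.2.1.symm) ?_)
      rw [List.eq_nil_of_length_eq_zero a.2.2, List.eq_nil_of_length_eq_zero b.2.2]
    rw [this, Nat.cast_one]
  | succ n ih =>
    rw [pow_succ', ← Matrix.mulVec_mulVec]
    rw [Nat.card_congr (Γ.pathSuccEquiv v n), Nat.card_sigma, Nat.cast_sum]
    simp only [Matrix.mulVec, dotProduct] at ih ⊢
    simp only [ih]
    have h1 : ∀ w, Γ.adjMatrix v w = ∑ e : {e : E // Γ.r e = v}, if Γ.s e.1 = w then 1 else 0 := by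
      intro w
      rw [Finset.sum_boole]
      simp only [adjMatrix]
      congr 1
      rw [← Fintype.card_subtype, ← Nat.card_eq_fintype_card]
      refine Nat.card_congr (Equiv.subtypeSubtypeEquivSubtypeInter _ _).symm
    simp only [h1, Finset.sum_mul]
    rw [Finset.sum_comm]
    refine Finset.sum_congr rfl fun e _ => ?_
    simp

attribute [local instance] Matrix.linftyOpNormedRing Matrix.linftyOpNormedAlgebra

open Classical in
theorem summable_card [Fintype V] [Fintype E] {β : ℝ} (hβ : ENNReal.log Γ.rho < (β : EReal)) :
    Summable fun k : ℕ => Real.exp (-β * k) * (Fintype.card (Γ.PathLen k) : ℝ) := by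
  have h1 : Γ.rho < ENNReal.ofReal (Real.exp β) := by
    have h := EReal.log_exp (β : EReal)
    rw [EReal.exp_coe] at h
    rw [← h] at hβ
    exact ENNReal.log_strictMono.lt_iff_lt.1 hβ
  obtain ⟨r, hr1, hr2⟩ := ENNReal.lt_iff_exists_nnreal_btwn.1 h1
  have hr3 : (r : ℝ) < Real.exp β := by
    rw [← ENNReal.ofReal_coe_nnreal, ENNReal.ofReal_lt_ofReal_iff (Real.exp_pos _)] at hr2
    exact hr2
  have hcard : ∀ k, (Fintype.card (Γ.PathLen k) : ℝ) ≤ Fintype.card V * ‖Γ.adjMatrix ^ k‖ := by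
    intro k
    have e : Γ.PathLen k ≃ Σ v : V, Γ.PathFromLen v k :=
      { toFun := fun μ => ⟨μ.1.r, ⟨μ.1, rfl, μ.2⟩⟩
        invFun := fun x => ⟨x.2.1, x.2.2.2⟩
        left_inv := fun _ => rfl
        right_inv := by rintro ⟨v, ⟨μ, rfl, h⟩⟩; rfl }
    rw [← Nat.card_eq_fintype_card, Nat.card_congr e, Nat.card_sigma, Nat.cast_sum]
    calc ∑ v, (Nat.card (Γ.PathFromLen v k) : ℝ) ≤ ∑ v : V, ‖Γ.adjMatrix ^ k‖ := by
          refine Finset.sum_le_sum fun v _ => ?_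
          have h2 := norm_le_pi_norm ((Γ.adjMatrix ^ k).mulVec (fun _ => 1)) v
          rw [pow_mulVec_one, Complex.norm_natCast] at h2
          refine h2.trans ((Matrix.linfty_opNorm_mulVec _ _).trans ?_)
          have : ‖(fun _ => 1 : V → ℂ)‖ ≤ 1 := (pi_norm_le_iff_of_nonneg zero_le_one).2 (by simp)
          exact mul_le_of_le_one_right (norm_nonneg _) this
      _ = _ := by simp
  have hev : ∀ᶠ k : ℕ in atTop, ‖Γ.adjMatrix ^ k‖ ≤ (r : ℝ) ^ k := by
    have := spectrum.pow_nnnorm_pow_one_div_tendsto_nhds_spectralRadius Γ.adjMatrix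
    filter_upwards [this.eventually (gt_mem_nhds hr1), eventually_gt_atTop 0] with k hk hk0
    have hk0' : (k : ℝ) ≠ 0 := by positivity
    have h3 := ENNReal.rpow_le_rpow hk.le (Nat.cast_nonneg k : (0 : ℝ) ≤ k)
    rw [← ENNReal.rpow_mul, one_div, inv_mul_cancel₀ hk0', ENNReal.rpow_one,
      ENNReal.rpow_natCast] at h3
    exact_mod_cast h3
  have hgeo : Summable fun k : ℕ => (Fintype.card V : ℝ) * (Real.exp (-β) * r) ^ k := by
    refine Summable.mul_left _ (summable_geometric_of_lt_one (by positivity) ?_)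
    rw [Real.exp_neg, inv_mul_lt_one₀ (Real.exp_pos _)]
    exact hr3
  refine Summable.of_norm_bounded_eventually_nat hgeo ?_
  filter_upwards [hev] with k hk
  rw [Real.norm_of_nonneg (by positivity)]
  calc Real.exp (-β * k) * (Fintype.card (Γ.PathLen k) : ℝ)
      ≤ Real.exp (-β * k) * (Fintype.card V * r ^ k) := by
        gcongr
        exact (hcard k).trans (by gcongr)
    _ = _ := by
        rw [mul_comm (-β), Real.exp_nat_mul]; ring

end DirGraph

theorem cstarGen_induction {A : Type*} [CStarAlgebra A] {s : Set A} {P : cstarGen s → Prop}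
    (hc : IsClosed {x | P x})
    (h : ∀ (x : A) (hx : x ∈ StarAlgebra.adjoin ℂ s),
      P ⟨x, StarSubalgebra.le_topologicalClosure _ hx⟩) (x : cstarGen s) : P x := by
  have hd : Dense {y : cstarGen s | y.1 ∈ StarAlgebra.adjoin ℂ s} := by
    rw [Subtype.dense_iff]
    intro y hy
    have hy' : y ∈ closure (StarAlgebra.adjoin ℂ s : Set A) := hy
    refine closure_mono ?_ hy'
    intro z hz
    exact ⟨⟨z, StarSubalgebra.le_topologicalClosure _ hz⟩, hz, rfl⟩
  have : x ∈ closure {y : cstarGen s | y.1 ∈ StarAlgebra.adjoin ℂ s} := hd x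
  exact closure_minimal (fun y hy => h y.1 hy) hc this

namespace SelfSimilarAction
section Fock

variable {V E : Type u} {Γ : DirGraph V E} [Groupoid.{u} V] [Fintype V] [Fintype E]
  (S : SelfSimilarAction Γ)

/-- The Toeplitz representation on the Fock space of a groupoid representation. -/
noncomputable def fock (i : GroupoidRep.Bundled V) : ToeplitzRep.Bundled S :=
  (S.exists_fock i).choose

/-- The inclusion of the summand of the Fock space indexed by a path. -/
noncomputable def fockJ (i : GroupoidRep.Bundled V) (l : Γ.Path) : i.H →L[ℂ] (S.fock i).H :=
  (S.exists_fock i).choose_spec.choose l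

section
variable (i : GroupoidRep.Bundled V)

theorem fock_v {v w : V} (g : v ⟶ w) (l : Γ.Path) (h : l.r = v) (x : i.H) :
    (S.fock i).rep.v g (S.fockJ i l x) =
      S.fockJ i (S.smul g ⟨l, h⟩).1 (i.rep.v (S.restrict g ⟨l, h⟩) x) :=
  (S.exists_fock i).choose_spec.choose_spec.1 g l h x

theorem fock_v_eq_zero {v w : V} (g : v ⟶ w) (l : Γ.Path) (h : l.r ≠ v) (x : i.H) :
    (S.fock i).rep.v g (S.fockJ i l x) = 0 :=
  (S.exists_fock i).choose_spec.choose_spec.2.1 g l x h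

theorem fock_t (e : E) (l : Γ.Path) (h : l.r = Γ.s e) (x : i.H) :
    (S.fock i).rep.t e (S.fockJ i l x) = S.fockJ i (consPath e l h) x :=
  (S.exists_fock i).choose_spec.choose_spec.2.2.1 e l h x

theorem fock_t_eq_zero (e : E) (l : Γ.Path) (h : l.r ≠ Γ.s e) (x : i.H) :
    (S.fock i).rep.t e (S.fockJ i l x) = 0 :=
  (S.exists_fock i).choose_spec.choose_spec.2.2.2.1 e l x h

theorem fock_star_t (e : E) (l : Γ.Path) (h : l.r = Γ.s e) (x : i.H) :
    star ((S.fock i).rep.t e) (S.fockJ i (consPath e l h) x) = S.fockJ i l x :=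
  (S.exists_fock i).choose_spec.choose_spec.2.2.2.2.1 e l h x

theorem fock_star_t_eq_zero (e : E) (k : Γ.Path)
    (h : ∀ (l : Γ.Path) (h : l.r = Γ.s e), k ≠ consPath e l h) (x : i.H) :
    star ((S.fock i).rep.t e) (S.fockJ i k x) = 0 :=
  (S.exists_fock i).choose_spec.choose_spec.2.2.2.2.2.1 e k x h

theorem fockJ_inner (l : Γ.Path) (x y : i.H) :
    inner ℂ (S.fockJ i l x) (S.fockJ i l y) = inner ℂ x (i.rep.v (𝟙 l.s) y) :=
  (S.exists_fock i).choose_spec.choose_spec.2.2.2.2.2.2.1 l x y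

theorem fockJ_inner_ne {l k : Γ.Path} (h : l ≠ k) (x y : i.H) :
    inner ℂ (S.fockJ i l x) (S.fockJ i k y) = 0 :=
  (S.exists_fock i).choose_spec.choose_spec.2.2.2.2.2.2.2 l k x y h

/-- The adjoint of `fockJ`. -/
noncomputable def fockA (l : Γ.Path) : (S.fock i).H →L[ℂ] i.H :=
  ContinuousLinearMap.adjoint (S.fockJ i l)

theorem fockA_fockJ (l : Γ.Path) (x : i.H) :
    S.fockA i l (S.fockJ i l x) = i.rep.v (𝟙 l.s) x := by
  refine ext_inner_left ℂ fun y => ?_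
  rw [fockA, ContinuousLinearMap.adjoint_inner_right, fockJ_inner]

theorem fockA_fockJ_ne {l k : Γ.Path} (h : l ≠ k) (x : i.H) :
    S.fockA i l (S.fockJ i k x) = 0 := by
  refine ext_inner_left ℂ fun y => ?_
  rw [fockA, ContinuousLinearMap.adjoint_inner_right, S.fockJ_inner_ne i h, inner_zero_right]

theorem norm_fockJ_le (l : Γ.Path) : ‖S.fockJ i l‖ ≤ 1 := by
  refine ContinuousLinearMap.opNorm_le_bound _ zero_le_one fun x => ?_
  rw [one_mul]
  have h1 : ‖S.fockJ i l x‖ ^ 2 ≤ ‖x‖ ^ 2 := by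
    have h := S.fockJ_inner i l x x
    rw [inner_self_eq_norm_sq_to_K] at h
    have h2 : ‖inner ℂ x (i.rep.v (𝟙 l.s) x)‖ ≤ ‖x‖ * ‖x‖ :=
      (norm_inner_le_norm _ _).trans (by
        gcongr
        exact ((i.rep.v (𝟙 l.s)).le_opNorm x).trans
          (mul_le_of_le_one_left (norm_nonneg _) (i.rep.norm_le _)))
    rw [← h] at h2
    simpa [sq] using h2
  exact (sq_le_sq₀ (norm_nonneg _) (norm_nonneg _)).1 h1

theorem norm_fockA_le (l : Γ.Path) : ‖S.fockA i l‖ ≤ 1 := by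
  rw [fockA, LinearIsometryEquiv.norm_map]; exact S.norm_fockJ_le i l

theorem fockJ_id (l : Γ.Path) (x : i.H) :
    S.fockJ i l (i.rep.v (𝟙 l.s) x) = S.fockJ i l x := by
  have h : inner ℂ (S.fockJ i l (i.rep.v (𝟙 l.s) x - x)) (S.fockJ i l (i.rep.v (𝟙 l.s) x - x))
      = 0 := by
    rw [fockJ_inner, map_sub, i.rep.id_apply, sub_self, inner_zero_right]
  rw [inner_self_eq_zero, map_sub, sub_eq_zero] at h
  exact h

theorem fockJ_congr {l k : Γ.Path} {x y : i.H} (h : l = k) (h' : x = y) :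
    S.fockJ i l x = S.fockJ i k y := by rw [h, h']

theorem fock_v_id (l : Γ.Path) (x : i.H) :
    (S.fock i).rep.v (𝟙 l.r) (S.fockJ i l x) = S.fockJ i l x := by
  rw [S.fock_v i (𝟙 l.r) l rfl x, ← S.fockJ_id i l x]
  refine S.fockJ_congr i ?_ ?_
  · rw [smul_id]
  · rw [i.rep.v_congr (S.arr_restrict_id ⟨l, rfl⟩)]

theorem fockA_v {v w : V} (g : v ⟶ w) (l : Γ.Path) (h : l.r = v) (y : (S.fock i).H) :
    S.fockA i (S.smul g ⟨l, h⟩).1 ((S.fock i).rep.v g y) =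
      i.rep.v (S.restrict g ⟨l, h⟩) (S.fockA i l y) := by
  refine ext_inner_left ℂ fun x => ?_
  have hi : Groupoid.inv (Groupoid.inv g) = g := by simp
  have h1 := (S.fock i).rep.toGroupoidRep.inner_v (Groupoid.inv g)
    (S.fockJ i (S.smul g ⟨l, h⟩).1 x) y
  rw [hi, S.fock_v i _ _ (S.smul g ⟨l, h⟩).2] at h1
  have h2 : S.fockJ i (S.smul (Groupoid.inv g) (S.smul g ⟨l, h⟩)).1
      (i.rep.v (S.restrict (Groupoid.inv g) (S.smul g ⟨l, h⟩)) x) =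
      S.fockJ i l (i.rep.v (Groupoid.inv (S.restrict g ⟨l, h⟩)) x) :=
    S.fockJ_congr i (by rw [inv_smul_smul])
      (by rw [i.rep.v_congr (S.arr_restrict_inv g ⟨l, h⟩)])
  have h3 := i.rep.inner_v (Groupoid.inv (S.restrict g ⟨l, h⟩)) x (S.fockA i l y)
  have hi' : Groupoid.inv (Groupoid.inv (S.restrict g ⟨l, h⟩)) = S.restrict g ⟨l, h⟩ := by simp
  rw [hi'] at h3
  rw [← h3, fockA, fockA, ContinuousLinearMap.adjoint_inner_right,
    ContinuousLinearMap.adjoint_inner_right, ← h1]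
  exact congrArg (fun z => inner ℂ z y) h2

theorem fockA_v_eq_zero {v w : V} (g : v ⟶ w) (l : Γ.Path) (h : l.r ≠ w) (y : (S.fock i).H) :
    S.fockA i l ((S.fock i).rep.v g y) = 0 := by
  refine ext_inner_left ℂ fun x => ?_
  have h1 := (S.fock i).rep.toGroupoidRep.inner_v (Groupoid.inv g) (S.fockJ i l x) y
  have hi : Groupoid.inv (Groupoid.inv g) = g := by simp
  rw [S.fock_v_eq_zero i _ l h, inner_zero_left, hi] at h1
  rw [fockA, ContinuousLinearMap.adjoint_inner_right, inner_zero_right, h1]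

end
end Fock
end SelfSimilarAction

namespace SelfSimilarAction
section Entries

variable {V E : Type u} {Γ : DirGraph V E} [Groupoid.{u} V] [Fintype V] [Fintype E]
  (S : SelfSimilarAction Γ)

/-- Columns: finite sums of operators `J_l ∘ b` with `b ∈ C^*(𝒢)`. -/
noncomputable def col : Submodule ℂ (∀ i : GroupoidRep.Bundled V, i.H →L[ℂ] (S.fock i).H) :=
  Submodule.span ℂ {f | ∃ (l : Γ.Path) (b : GroupoidCStar V),
    f = fun i => (S.fockJ i l).comp (OpFamily.eval i b.1)}

/-- The product of an element of the ambient algebra and a column. -/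
noncomputable def mulCol (a : ToeplitzRep.Ambient S)
    (f : ∀ i : GroupoidRep.Bundled V, i.H →L[ℂ] (S.fock i).H) :
    ∀ i : GroupoidRep.Bundled V, i.H →L[ℂ] (S.fock i).H :=
  fun i => (OpFamily.eval (S.fock i) a).comp (f i)

theorem gen_mem_col (l : Γ.Path) (b : GroupoidCStar V) :
    (fun i => (S.fockJ i l).comp (OpFamily.eval i b.1)) ∈ S.col :=
  Submodule.subset_span ⟨l, b, rfl⟩

theorem mulCol_mem_of_gen {a : ToeplitzRep.Ambient S}
    (h : ∀ (l : Γ.Path) (b : GroupoidCStar V),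
      S.mulCol a (fun i => (S.fockJ i l).comp (OpFamily.eval i b.1)) ∈ S.col) :
    ∀ f ∈ S.col, S.mulCol a f ∈ S.col := by
  intro f hf
  induction hf using Submodule.span_induction with
  | mem f hf =>
    obtain ⟨l, b, rfl⟩ := hf
    exact h l b
  | zero =>
    have : S.mulCol a 0 = 0 := by
      funext i; exact ContinuousLinearMap.comp_zero _
    rw [this]; exact S.col.zero_mem
  | add f g _ _ hf hg =>
    have : S.mulCol a (f + g) = S.mulCol a f + S.mulCol a g := by
      funext i; exact ContinuousLinearMap.comp_add _ _ _
    rw [this]; exact S.col.add_mem hf hg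
  | smul c f _ hf =>
    have : S.mulCol a (c • f) = c • S.mulCol a f := by
      funext i; exact ContinuousLinearMap.comp_smul _ _ _
    rw [this]; exact S.col.smul_mem c hf

theorem mulCol_univV {v w : V} (g : v ⟶ w) :
    ∀ f ∈ S.col, S.mulCol (ToeplitzRep.univV S g) f ∈ S.col := by
  refine S.mulCol_mem_of_gen fun l b => ?_
  by_cases h : l.r = v
  · have := S.gen_mem_col (S.smul g ⟨l, h⟩).1 (GroupoidCStar.u (S.restrict g ⟨l, h⟩) * b)
    convert this using 1
    funext i
    ext x
    exact S.fock_v i g l h _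
  · have : S.mulCol (ToeplitzRep.univV S g)
        (fun i => (S.fockJ i l).comp (OpFamily.eval i b.1)) = 0 := by
      funext i
      ext x
      exact S.fock_v_eq_zero i g l h _
    rw [this]; exact S.col.zero_mem

theorem mulCol_univT (e : E) :
    ∀ f ∈ S.col, S.mulCol (ToeplitzRep.univT S e) f ∈ S.col := by
  refine S.mulCol_mem_of_gen fun l b => ?_
  by_cases h : l.r = Γ.s e
  · convert S.gen_mem_col (consPath e l h) b using 1
    funext i
    ext x
    exact S.fock_t i e l h _
  · have : S.mulCol (ToeplitzRep.univT S e)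
        (fun i => (S.fockJ i l).comp (OpFamily.eval i b.1)) = 0 := by
      funext i
      ext x
      exact S.fock_t_eq_zero i e l h _
    rw [this]; exact S.col.zero_mem

theorem mulCol_star_univT (e : E) :
    ∀ f ∈ S.col, S.mulCol (star (ToeplitzRep.univT S e)) f ∈ S.col := by
  refine S.mulCol_mem_of_gen fun k b => ?_
  by_cases h : ∃ (l : Γ.Path) (h : l.r = Γ.s e), k = consPath e l h
  · obtain ⟨l, h, rfl⟩ := h
    convert S.gen_mem_col l b using 1
    funext i
    ext x
    exact S.fock_star_t i e l h _
  · have : S.mulCol (star (ToeplitzRep.univT S e))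
        (fun i => (S.fockJ i k).comp (OpFamily.eval i b.1)) = 0 := by
      funext i
      ext x
      exact S.fock_star_t_eq_zero i e k (fun l hl hk => h ⟨l, hl, hk⟩) _
    rw [this]; exact S.col.zero_mem

theorem star_univV {v w : V} (g : v ⟶ w) :
    star (ToeplitzRep.univV S g) = ToeplitzRep.univV S (Groupoid.inv g) :=
  OpFamily.ext fun i => (i.rep.inv g).symm

/-- The generators of the Toeplitz algebra. -/
abbrev gens : Set (ToeplitzRep.Ambient S) :=
  {x : ToeplitzRep.Ambient S | ∃ (a b : V) (g : a ⟶ b), x = ToeplitzRep.univV S g} ∪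
    Set.range (ToeplitzRep.univT S)

theorem mulCol_adjoin {a : ToeplitzRep.Ambient S} (ha : a ∈ StarAlgebra.adjoin ℂ S.gens) :
    (∀ f ∈ S.col, S.mulCol a f ∈ S.col) ∧ ∀ f ∈ S.col, S.mulCol (star a) f ∈ S.col := by
  induction ha using StarAlgebra.adjoin_induction with
  | mem x hx =>
    rcases hx with ⟨a, b, g, rfl⟩ | ⟨e, rfl⟩
    · rw [star_univV]
      exact ⟨S.mulCol_univV g, S.mulCol_univV _⟩
    · exact ⟨S.mulCol_univT e, S.mulCol_star_univT e⟩
  | algebraMap c =>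
    have h : ∀ c : ℂ, ∀ f ∈ S.col, S.mulCol (algebraMap ℂ (ToeplitzRep.Ambient S) c) f ∈ S.col := by
      intro c f hf
      have : S.mulCol (algebraMap ℂ (ToeplitzRep.Ambient S) c) f = c • f := by
        funext i
        ext x
        simp only [mulCol, AlgHomClass.commutes]
        rfl
      rw [this]; exact S.col.smul_mem c hf
    refine ⟨h c, ?_⟩
    rw [← algebraMap_star_comm]
    exact h _
  | add x y _ _ hx hy =>
    have h : ∀ (x y : ToeplitzRep.Ambient S) f,
        S.mulCol (x + y) f = S.mulCol x f + S.mulCol y f := by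
      intro x y f
      funext i
      simp only [mulCol, map_add, Pi.add_apply, ContinuousLinearMap.add_comp]
    rw [star_add]
    refine ⟨fun f hf => ?_, fun f hf => ?_⟩
    · rw [h]; exact S.col.add_mem (hx.1 f hf) (hy.1 f hf)
    · rw [h]; exact S.col.add_mem (hx.2 f hf) (hy.2 f hf)
  | mul x y _ _ hx hy =>
    have h : ∀ (x y : ToeplitzRep.Ambient S) f,
        S.mulCol (x * y) f = S.mulCol x (S.mulCol y f) := by
      intro x y f
      funext i
      simp only [mulCol, map_mul]
      rfl
    rw [star_mul]
    refine ⟨fun f hf => ?_, fun f hf => ?_⟩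
    · rw [h]; exact hx.1 _ (hy.1 f hf)
    · rw [h]; exact hy.2 _ (hx.2 f hf)
  | star x _ hx => rw [star_star]; exact ⟨hx.2, hx.1⟩

theorem fockA_col {f : ∀ i : GroupoidRep.Bundled V, i.H →L[ℂ] (S.fock i).H} (hf : f ∈ S.col)
    (l : Γ.Path) : ∃ b : GroupoidCStar V, ∀ i, OpFamily.eval i b.1 = (S.fockA i l).comp (f i) := by
  classical
  induction hf using Submodule.span_induction with
  | mem f hf =>
    obtain ⟨k, b, rfl⟩ := hf
    by_cases h : l = k
    · subst h
      refine ⟨GroupoidCStar.u (𝟙 l.s) * b, fun i => ?_⟩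
      ext x
      exact (S.fockA_fockJ i l _).symm
    · refine ⟨0, fun i => ?_⟩
      ext x
      exact (S.fockA_fockJ_ne i h _).symm
  | zero => exact ⟨0, fun i => (ContinuousLinearMap.comp_zero _).symm⟩
  | add f g _ _ hf hg =>
    obtain ⟨b, hb⟩ := hf
    obtain ⟨c, hc⟩ := hg
    refine ⟨b + c, fun i => ?_⟩
    rw [Pi.add_apply, ContinuousLinearMap.comp_add, ← hb, ← hc]
    rfl
  | smul z f _ hf =>
    obtain ⟨b, hb⟩ := hf
    refine ⟨z • b, fun i => ?_⟩
    rw [Pi.smul_apply, ContinuousLinearMap.comp_smul, ← hb]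
    rfl

theorem col_support {f : ∀ i : GroupoidRep.Bundled V, i.H →L[ℂ] (S.fock i).H} (hf : f ∈ S.col) :
    ∃ s : Finset Γ.Path, ∀ t, s ⊆ t → ∀ i x,
      f i x = ∑ m ∈ t, S.fockJ i m (S.fockA i m (f i x)) := by
  classical
  induction hf using Submodule.span_induction with
  | mem f hf =>
    obtain ⟨k, b, rfl⟩ := hf
    refine ⟨{k}, fun t ht i x => ?_⟩
    have hk : k ∈ t := ht (Finset.mem_singleton_self k)
    change S.fockJ i k (OpFamily.eval i b.1 x) =
      ∑ m ∈ t, S.fockJ i m (S.fockA i m (S.fockJ i k (OpFamily.eval i b.1 x)))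
    rw [Finset.sum_eq_single_of_mem k hk, fockA_fockJ, fockJ_id]
    intro m _ hm
    rw [S.fockA_fockJ_ne i hm, map_zero]
  | zero => exact ⟨∅, fun t _ i x => by simp⟩
  | add f g _ _ hf hg =>
    obtain ⟨s, hs⟩ := hf
    obtain ⟨s', hs'⟩ := hg
    refine ⟨s ∪ s', fun t ht i x => ?_⟩
    have h1 := hs t (Finset.union_subset_left ht) i x
    have h2 := hs' t (Finset.union_subset_right ht) i x
    simp only [Pi.add_apply, add_apply, map_add, Finset.sum_add_distrib]
    rw [← h1, ← h2]
  | smul z f _ hf =>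
    obtain ⟨s, hs⟩ := hf
    refine ⟨s, fun t ht i x => ?_⟩
    have h1 := hs t ht i x
    simp only [Pi.smul_apply, smul_apply, map_smul, ← Finset.smul_sum]
    rw [← h1]

/-- The family of operators `A_l a J_k`. -/
noncomputable def entryAux (l k : Γ.Path) :
    ToeplitzRep.Ambient S →L[ℂ] GroupoidRep.Ambient V :=
  LinearMap.mkContinuous
    { toFun := fun a => OpFamily.mk (fun i => (S.fockA i l).comp
          ((OpFamily.eval (S.fock i) a).comp (S.fockJ i k))) ‖a‖ (fun i => by
            have h1 := ContinuousLinearMap.opNorm_comp_le (S.fockA i l)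
              ((OpFamily.eval (S.fock i) a).comp (S.fockJ i k))
            have h2 := ContinuousLinearMap.opNorm_comp_le (OpFamily.eval (S.fock i) a)
              (S.fockJ i k)
            have h3 := OpFamily.norm_eval_le a (S.fock i)
            have h4 := S.norm_fockJ_le i k
            have h5 := S.norm_fockA_le i l
            refine h1.trans ((mul_le_of_le_one_left (norm_nonneg _) h5).trans
              (h2.trans ((mul_le_of_le_one_right (norm_nonneg _) h4).trans h3)))) 
      map_add' := fun a b => OpFamily.ext fun i => by
        ext x
        change S.fockA i l (OpFamily.eval (S.fock i) (a + b) (S.fockJ i k x)) =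
          S.fockA i l (OpFamily.eval (S.fock i) a (S.fockJ i k x)) +
          S.fockA i l (OpFamily.eval (S.fock i) b (S.fockJ i k x))
        rw [map_add, add_apply, map_add]
      map_smul' := fun c a => OpFamily.ext fun i => by
        ext x
        change S.fockA i l (OpFamily.eval (S.fock i) (c • a) (S.fockJ i k x)) =
          c • S.fockA i l (OpFamily.eval (S.fock i) a (S.fockJ i k x))
        rw [map_smul, smul_apply, map_smul] } 1
    fun a => by
      rw [one_mul]
      refine OpFamily.norm_le (norm_nonneg _) fun i => ?_
      have h1 := ContinuousLinearMap.opNorm_comp_le (S.fockA i l)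
        ((OpFamily.eval (S.fock i) a).comp (S.fockJ i k))
      have h2 := ContinuousLinearMap.opNorm_comp_le (OpFamily.eval (S.fock i) a)
        (S.fockJ i k)
      have h3 := OpFamily.norm_eval_le a (S.fock i)
      have h4 := S.norm_fockJ_le i k
      have h5 := S.norm_fockA_le i l
      exact h1.trans ((mul_le_of_le_one_left (norm_nonneg _) h5).trans
        (h2.trans ((mul_le_of_le_one_right (norm_nonneg _) h4).trans h3)))

theorem entryAux_apply (l k : Γ.Path) (a : ToeplitzRep.Ambient S) (i : GroupoidRep.Bundled V)
    (x : i.H) : OpFamily.eval i (S.entryAux l k a) x =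
      S.fockA i l (OpFamily.eval (S.fock i) a (S.fockJ i k x)) := rfl

theorem norm_entryAux_le (l k : Γ.Path) (a : ToeplitzRep.Ambient S) :
    ‖S.entryAux l k a‖ ≤ ‖a‖ := by
  refine OpFamily.norm_le (norm_nonneg _) fun i => ?_
  have h1 := ContinuousLinearMap.opNorm_comp_le (S.fockA i l)
    ((OpFamily.eval (S.fock i) a).comp (S.fockJ i k))
  have h2 := ContinuousLinearMap.opNorm_comp_le (OpFamily.eval (S.fock i) a)
    (S.fockJ i k)
  have h3 := OpFamily.norm_eval_le a (S.fock i)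
  have h4 := S.norm_fockJ_le i k
  have h5 := S.norm_fockA_le i l
  exact h1.trans ((mul_le_of_le_one_left (norm_nonneg _) h5).trans
    (h2.trans ((mul_le_of_le_one_right (norm_nonneg _) h4).trans h3)))

theorem fockJ_mem_col (k : Γ.Path) : (fun i => S.fockJ i k) ∈ S.col := S.gen_mem_col k 1

theorem entryAux_mem (l k : Γ.Path) (a : S.Toeplitz) :
    ∃ b : GroupoidCStar V, S.entryAux l k a.1 = b.1 := by
  have := cstarGen_induction (s := S.gens)
    (P := fun a => S.entryAux l k a.1 ∈ (cstarGen
      {x : GroupoidRep.Ambient V | ∃ (a b : V) (g : a ⟶ b), x = GroupoidRep.univ g} :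
      StarSubalgebra ℂ (GroupoidRep.Ambient V)))
    ((inferInstance : IsClosed ((cstarGen
      {x : GroupoidRep.Ambient V | ∃ (a b : V) (g : a ⟶ b), x = GroupoidRep.univ g} :
      StarSubalgebra ℂ (GroupoidRep.Ambient V)) : Set (GroupoidRep.Ambient V))).preimage
      ((S.entryAux l k).continuous.comp continuous_subtype_val))
    (fun x hx => by
      obtain ⟨b, hb⟩ := S.fockA_col ((S.mulCol_adjoin hx).1 _ (S.fockJ_mem_col k)) l
      have : S.entryAux l k x = b.1 := OpFamily.ext fun i => (hb i).symm
      change S.entryAux l k x ∈ _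
      rw [this]; exact b.2) a
  exact ⟨⟨_, this⟩, rfl⟩

end Entries
end SelfSimilarAction

namespace SelfSimilarAction
section Entries

variable {V E : Type u} {Γ : DirGraph V E} [Groupoid.{u} V] [Fintype V] [Fintype E]
  (S : SelfSimilarAction Γ)

/-- The representation of the Toeplitz algebra on a Fock space. -/
noncomputable def rep (i : GroupoidRep.Bundled V) :
    S.Toeplitz →⋆ₐ[ℂ] ((S.fock i).H →L[ℂ] (S.fock i).H) :=
  (OpFamily.eval (S.fock i)).comp (StarSubalgebra.subtype (cstarGen S.gens))

/-- The operators of an element of `C^*(𝒢)`. -/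
noncomputable def _root_.GroupoidCStar.rep (i : GroupoidRep.Bundled V) :
    GroupoidCStar V →⋆ₐ[ℂ] (i.H →L[ℂ] i.H) :=
  (OpFamily.eval i).comp (StarSubalgebra.subtype (cstarGen
    {x : GroupoidRep.Ambient V | ∃ (a b : V) (g : a ⟶ b), x = GroupoidRep.univ g}))

theorem _root_.GroupoidCStar.ext_rep {a b : GroupoidCStar V}
    (h : ∀ i x, GroupoidCStar.rep i a x = GroupoidCStar.rep i b x) : a = b :=
  Subtype.ext (OpFamily.ext fun i => ContinuousLinearMap.ext (h i))

/-- The matrix entry `A_l a J_k`, as an element of `C^*(𝒢)`. -/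
noncomputable def entry (l k : Γ.Path) : S.Toeplitz →L[ℂ] GroupoidCStar V :=
  LinearMap.mkContinuous
    { toFun := fun a => (S.entryAux_mem l k a).choose
      map_add' := fun a b => Subtype.ext (by
        refine (S.entryAux_mem l k (a + b)).choose_spec.symm.trans ?_
        refine (map_add (S.entryAux l k) a.1 b.1).trans ?_
        exact congrArg₂ _ (S.entryAux_mem l k a).choose_spec (S.entryAux_mem l k b).choose_spec)
      map_smul' := fun c a => Subtype.ext (by
        refine (S.entryAux_mem l k (c • a)).choose_spec.symm.trans ?_
        refine (map_smul (S.entryAux l k) c a.1).trans ?_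
        exact congrArg _ (S.entryAux_mem l k a).choose_spec) } 1
    (fun a => by
      rw [one_mul]
      change ‖((S.entryAux_mem l k a).choose).1‖ ≤ ‖a.1‖
      rw [← (S.entryAux_mem l k a).choose_spec]
      exact S.norm_entryAux_le l k a.1)

theorem entry_apply (l k : Γ.Path) (a : S.Toeplitz) (i : GroupoidRep.Bundled V) (x : i.H) :
    GroupoidCStar.rep i (S.entry l k a) x = S.fockA i l (S.rep i a (S.fockJ i k x)) := by
  refine Eq.trans ?_ (S.entryAux_apply l k a.1 i x)
  change OpFamily.eval i ((S.entryAux_mem l k a).choose).1 x = _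
  rw [← (S.entryAux_mem l k a).choose_spec]

theorem norm_entry_le (l k : Γ.Path) (a : S.Toeplitz) : ‖S.entry l k a‖ ≤ ‖a‖ := by
  change ‖((S.entryAux_mem l k a).choose).1‖ ≤ _
  rw [← (S.entryAux_mem l k a).choose_spec]
  exact S.norm_entryAux_le l k a.1

theorem entry_one (l : Γ.Path) : S.entry l l 1 = GroupoidCStar.u (𝟙 l.s) := by
  refine GroupoidCStar.ext_rep fun i x => ?_
  rw [entry_apply, map_one]
  exact S.fockA_fockJ i l x

theorem entry_mul_u {v w : V} (g : v ⟶ w) (m l : Γ.Path) (h : l.r = v) (a : S.Toeplitz) :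
    S.entry m l (a * S.u g) =
      S.entry m (S.smul g ⟨l, h⟩).1 a * GroupoidCStar.u (S.restrict g ⟨l, h⟩) := by
  refine GroupoidCStar.ext_rep fun i x => ?_
  rw [entry_apply, map_mul, map_mul, clm_mul_apply, clm_mul_apply, entry_apply]
  exact congrArg (fun z => S.fockA i m (S.rep i a z)) (S.fock_v i g l h x)

theorem entry_mul_u_eq_zero {v w : V} (g : v ⟶ w) (m l : Γ.Path) (h : l.r ≠ v)
    (a : S.Toeplitz) : S.entry m l (a * S.u g) = 0 := by
  refine GroupoidCStar.ext_rep fun i x => ?_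
  rw [entry_apply, map_mul, clm_mul_apply, map_zero]
  have := S.fock_v_eq_zero i g l h x
  change S.rep i (S.u g) (S.fockJ i l x) = 0 at this
  rw [this, map_zero, map_zero]; rfl

theorem entry_u_mul {v w : V} (g : v ⟶ w) (m l : Γ.Path) (h : l.r = v) (a : S.Toeplitz) :
    S.entry (S.smul g ⟨l, h⟩).1 m (S.u g * a) =
      GroupoidCStar.u (S.restrict g ⟨l, h⟩) * S.entry l m a := by
  refine GroupoidCStar.ext_rep fun i x => ?_
  rw [entry_apply, map_mul, map_mul, clm_mul_apply, clm_mul_apply, entry_apply]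
  exact S.fockA_v i g l h _

theorem entry_u_mul_eq_zero {v w : V} (g : v ⟶ w) (m l : Γ.Path) (h : l.r ≠ w)
    (a : S.Toeplitz) : S.entry l m (S.u g * a) = 0 := by
  refine GroupoidCStar.ext_rep fun i x => ?_
  rw [entry_apply, map_mul, clm_mul_apply, map_zero]
  exact S.fockA_v_eq_zero i g l h _

theorem entry_u {v w : V} (g : v ⟶ w) (l : Γ.Path) (h : l.r = v) :
    S.entry (S.smul g ⟨l, h⟩).1 l (S.u g) = GroupoidCStar.u (S.restrict g ⟨l, h⟩) := by
  refine GroupoidCStar.ext_rep fun i x => ?_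
  rw [entry_apply]
  refine (S.fockA_v i g l h _).trans ?_
  rw [S.fockA_fockJ]
  exact i.rep.apply_id _ _

theorem entry_u_ne {v w : V} (g : v ⟶ w) (m l : Γ.Path) (h : l.r = v)
    (hm : m ≠ (S.smul g ⟨l, h⟩).1) : S.entry m l (S.u g) = 0 := by
  refine GroupoidCStar.ext_rep fun i x => ?_
  rw [entry_apply]
  have := S.fock_v i g l h x
  change S.rep i (S.u g) (S.fockJ i l x) = _ at this
  rw [this, S.fockA_fockJ_ne i hm, map_zero]; rfl

/-- Positivity of the diagonal entries. -/
theorem entry_star_mul_self (l : Γ.Path) (a : ToeplitzRep.Ambient S)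
    (ha : a ∈ StarAlgebra.adjoin ℂ S.gens) (b : S.Toeplitz) (hb : b.1 = a) :
    ∃ s : Finset Γ.Path, S.entry l l (star b * b) =
      ∑ m ∈ s, star (S.entry m l b) * S.entry m l b := by
  subst hb
  obtain ⟨s, hs⟩ := S.col_support ((S.mulCol_adjoin ha).1 _ (S.fockJ_mem_col l))
  refine ⟨s, GroupoidCStar.ext_rep fun i x => ext_inner_left ℂ fun y => ?_⟩
  have h1 : S.rep i b (S.fockJ i l x) =
    ∑ m ∈ s, S.fockJ i m (S.fockA i m (S.rep i b (S.fockJ i l x))) := hs s (le_refl _) i x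
  rw [map_sum, sum_apply, inner_sum, entry_apply, map_mul, clm_mul_apply, map_star, fockA,
    ContinuousLinearMap.adjoint_inner_right, ContinuousLinearMap.star_eq_adjoint,
    ContinuousLinearMap.adjoint_inner_right]
  conv_lhs => rw [h1]
  rw [inner_sum]
  refine Finset.sum_congr rfl fun m _ => ?_
  rw [map_mul, clm_mul_apply, map_star, ContinuousLinearMap.star_eq_adjoint,
    ContinuousLinearMap.adjoint_inner_right, entry_apply, entry_apply]
  conv_rhs => rw [fockA, ContinuousLinearMap.adjoint_inner_left]
  rfl

end Entries
end SelfSimilarAction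

namespace SelfSimilarAction
section Entries

variable {V E : Type u} {Γ : DirGraph V E} [Groupoid.{u} V] [Fintype V] [Fintype E]
  (S : SelfSimilarAction Γ)

/-- The concatenation of two paths. -/
def _root_.DirGraph.Path.cat (μ l : Γ.Path) (h : l.r = μ.s) : Γ.Path :=
  ⟨μ.r, μ.edges ++ l.edges, Γ.isPath_append μ.isPath (by
    have := l.isPath; rw [h] at this; exact this)⟩

theorem rep_star_edges (i : GroupoidRep.Bundled V) (L : List E) (v : V) (hp : Γ.IsPath v L)
    (k : Γ.Path) (hk : k.r = v) (x : i.H) :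
    (∀ (l : Γ.Path) (_ : l.r = Γ.endpoint v L), k.edges = L ++ l.edges →
      S.rep i (star (L.map S.sEdge).prod) (S.fockJ i k x) = S.fockJ i l x) ∧
    ((∀ (l : Γ.Path) (_ : l.r = Γ.endpoint v L), k.edges ≠ L ++ l.edges) →
      S.rep i (star (L.map S.sEdge).prod) (S.fockJ i k x) = 0) := by
  induction L generalizing v k with
  | nil =>
    refine ⟨fun l hl h => ?_, fun h => absurd rfl (h k hk)⟩
    have : k = l := DirGraph.Path.ext (hk.trans hl.symm) h
    subst this
    simp
  | cons e L ih =>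
    have hmul : ∀ y, S.rep i (star (((e :: L).map S.sEdge).prod)) y =
        S.rep i (star (L.map S.sEdge).prod) (star ((S.fock i).rep.t e) y) := by
      intro y
      rw [List.map_cons, List.prod_cons, star_mul, map_mul, clm_mul_apply, map_star (S.rep i)
        (S.sEdge e)]
      rfl
    simp only [hmul]
    rcases path_cases k with h0 | ⟨e', l, hl, rfl⟩
    · refine ⟨fun l _ h => ?_, fun _ => ?_⟩
      · rw [h0] at h; simp at h
      · rw [S.fock_star_t_eq_zero, map_zero]
        rintro l hl rfl
        simp [consPath_edges] at h0
    · by_cases he : e' = e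
      · subst he
        obtain ⟨h1, h2⟩ := ih (Γ.s e') hp.2 l hl
        rw [S.fock_star_t]
        refine ⟨fun l' hl' h => h1 l' hl' ?_, fun h => h2 fun l' hl' h' => h l' hl' ?_⟩
        · simpa [consPath_edges] using h
        · simpa [consPath_edges] using h'
      · rw [S.fock_star_t_eq_zero i e _ (fun l' hl' h => he (consPath_inj h).1), map_zero]
        refine ⟨fun l' _ h => ?_, fun _ => rfl⟩
        simp [consPath_edges] at h
        exact absurd h.1 he

theorem star_u {v w : V} (g : v ⟶ w) : star (S.u g) = S.u (Groupoid.inv g) :=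
  Subtype.ext (S.star_univV g)

theorem rep_star_sPath (i : GroupoidRep.Bundled V) (μ k : Γ.Path) (x : i.H) :
    (∀ (l : Γ.Path) (h : l.r = μ.s), k = μ.cat l h →
      S.rep i (star (S.sPath μ)) (S.fockJ i k x) = S.fockJ i l x) ∧
    ((∀ (l : Γ.Path) (h : l.r = μ.s), k ≠ μ.cat l h) →
      S.rep i (star (S.sPath μ)) (S.fockJ i k x) = 0) := by
  have hi : Groupoid.inv (𝟙 μ.r) = 𝟙 μ.r := by simp
  have hmul : ∀ y, S.rep i (star (S.sPath μ)) y =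
      S.rep i (star (μ.edges.map S.sEdge).prod) ((S.fock i).rep.v (𝟙 μ.r) y) := by
    intro y
    rw [sPath, star_mul, star_u, hi, map_mul, clm_mul_apply]
    rfl
  simp only [hmul]
  by_cases hk : k.r = μ.r
  · obtain ⟨h1, h2⟩ := S.rep_star_edges i μ.edges μ.r μ.isPath k hk x
    have h3 : (S.fock i).rep.v (𝟙 μ.r) (S.fockJ i k x) = S.fockJ i k x := by
      rw [← hk]; exact S.fock_v_id i k x
    rw [h3]
    refine ⟨fun l hl h => h1 l hl ?_, fun h => h2 fun l hl h' => h l hl ?_⟩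
    · rw [h]; rfl
    · exact DirGraph.Path.ext hk h'
  · rw [S.fock_v_eq_zero i _ _ hk, map_zero]
    refine ⟨fun l hl h => ?_, fun _ => rfl⟩
    exact absurd (by rw [h]; rfl) hk

theorem fockA_sPath (i : GroupoidRep.Bundled V) (μ k : Γ.Path) (y : (S.fock i).H) :
    (∀ (l : Γ.Path) (h : l.r = μ.s), k = μ.cat l h →
      S.fockA i k (S.rep i (S.sPath μ) y) = S.fockA i l y) ∧
    ((∀ (l : Γ.Path) (h : l.r = μ.s), k ≠ μ.cat l h) →
      S.fockA i k (S.rep i (S.sPath μ) y) = 0) := by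
  have key : ∀ x, inner ℂ x (S.fockA i k (S.rep i (S.sPath μ) y)) =
      inner ℂ (S.rep i (star (S.sPath μ)) (S.fockJ i k x)) y := by
    intro x
    rw [fockA, ContinuousLinearMap.adjoint_inner_right, map_star,
      ContinuousLinearMap.star_eq_adjoint, ContinuousLinearMap.adjoint_inner_left]
  refine ⟨fun l hl h => ext_inner_left ℂ fun x => ?_, fun h => ext_inner_left ℂ fun x => ?_⟩
  · rw [key, (S.rep_star_sPath i μ k x).1 l hl h, fockA, ContinuousLinearMap.adjoint_inner_right]
  · rw [key, (S.rep_star_sPath i μ k x).2 h, inner_zero_left, inner_zero_right]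

theorem entry_formula (μ ν : Γ.Path) (a : S.Toeplitz) (k l l' : Γ.Path) (h : l.r = ν.s)
    (h' : l'.r = μ.s) (hk : k = ν.cat l h) (hk' : k = μ.cat l' h') :
    S.entry k k (S.sPath μ * a * star (S.sPath ν)) = S.entry l' l a := by
  refine GroupoidCStar.ext_rep fun i x => ?_
  rw [entry_apply, entry_apply, map_mul, map_mul, clm_mul_apply, clm_mul_apply,
    (S.rep_star_sPath i ν k x).1 l h hk, (S.fockA_sPath i μ k _).1 l' h' hk']

theorem entry_formula_zero (μ ν : Γ.Path) (a : S.Toeplitz) (k : Γ.Path)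
    (h : (∀ (l : Γ.Path) (h : l.r = ν.s), k ≠ ν.cat l h) ∨
      ∀ (l : Γ.Path) (h : l.r = μ.s), k ≠ μ.cat l h) :
    S.entry k k (S.sPath μ * a * star (S.sPath ν)) = 0 := by
  refine GroupoidCStar.ext_rep fun i x => ?_
  rw [entry_apply, map_mul, map_mul, clm_mul_apply, clm_mul_apply, map_zero]
  rcases h with h | h
  · rw [(S.rep_star_sPath i ν k x).2 h, map_zero, map_zero, map_zero]; rfl
  · rw [(S.fockA_sPath i μ k _).2 h]; rfl

end Entries
end SelfSimilarAction

namespace SelfSimilarAction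
section Psi

variable {V E : Type u} {Γ : DirGraph V E} [Groupoid.{u} V] [Fintype V] [Fintype E]
  (S : SelfSimilarAction Γ)

variable {β : ℝ} (τ : TracialState (GroupoidCStar V))

theorem toeplitz_induction {P : S.Toeplitz → Prop} (hc : IsClosed {a | P a})
    (h : ∀ a : S.Toeplitz, a.1 ∈ StarAlgebra.adjoin ℂ S.gens → P a) (a : S.Toeplitz) : P a :=
  cstarGen_induction (s := S.gens) hc (fun _ hx => h _ hx) a

theorem _root_.GroupoidCStar.sum_u : ∑ v : V, GroupoidCStar.u (𝟙 v) = 1 := by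
  refine GroupoidCStar.ext_rep fun i x => ?_
  rw [map_sum, map_one]
  exact congrArg (fun T => T x) i.rep.sum

theorem tau_entry_nonneg (l : Γ.Path) (a : S.Toeplitz) : 0 ≤ τ (S.entry l l (star a * a)) := by
  have hcl : IsClosed {a : S.Toeplitz | 0 ≤ τ (S.entry l l (star a * a))} := by
    refine isClosed_le continuous_const ?_
    exact τ.toCLM.continuous.comp ((S.entry l l).continuous.comp
      (continuous_star.mul continuous_id))
  refine S.toeplitz_induction hcl (fun b hb => ?_) a
  obtain ⟨s, hs⟩ := S.entry_star_mul_self l b.1 hb b rfl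
  rw [hs, map_sum]
  exact Finset.sum_nonneg fun m _ => τ.nonneg _

theorem tau_u_nonneg (v : V) : 0 ≤ τ (GroupoidCStar.u (𝟙 v)) := by
  have : GroupoidCStar.u (𝟙 v) = star (GroupoidCStar.u (𝟙 v)) * GroupoidCStar.u (𝟙 v) := by
    refine GroupoidCStar.ext_rep fun i x => ?_
    rw [map_mul, map_star, clm_mul_apply]
    change i.rep.v _ x = star (i.rep.v _) (i.rep.v _ x)
    rw [i.rep.star_id, i.rep.id_apply]
  rw [this]
  exact τ.nonneg _

/-- A diagonal sum. -/
noncomputable def diag (k : ℕ) : S.Toeplitz →L[ℂ] ℂ :=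
  (Real.exp (-β * k) : ℂ) • ∑ l : Γ.PathLen k, τ.toCLM.comp (S.entry l.1 l.1)

theorem diag_apply (k : ℕ) (a : S.Toeplitz) : S.diag (β := β) τ k a =
    (Real.exp (-β * k) : ℂ) * ∑ l : Γ.PathLen k, τ (S.entry l.1 l.1 a) := by
  simp [diag, sum_apply]

theorem summable_diag (hβ : ENNReal.log Γ.rho < (β : EReal)) : Summable (S.diag (β := β) τ) := by
  refine Summable.of_norm_bounded ((Γ.summable_card hβ).mul_right ‖τ.toCLM‖) fun k => ?_
  refine ContinuousLinearMap.opNorm_le_bound _ (by positivity) fun a => ?_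
  rw [diag_apply, norm_mul, Complex.norm_real, Real.norm_of_nonneg (Real.exp_pos _).le]
  rw [mul_assoc, mul_assoc]
  refine mul_le_mul_of_nonneg_left ?_ (Real.exp_pos _).le
  refine (norm_sum_le _ _).trans ?_
  have : ∀ l ∈ (Finset.univ : Finset (Γ.PathLen k)), ‖τ (S.entry l.1 l.1 a)‖ ≤
      ‖τ.toCLM‖ * ‖a‖ := fun l _ =>
    (τ.toCLM.le_opNorm _).trans (mul_le_mul_of_nonneg_left (S.norm_entry_le _ _ a) (norm_nonneg _))
  refine (Finset.sum_le_card_nsmul _ _ _ this).trans ?_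
  rw [nsmul_eq_mul]
  simp

theorem hasSum_diag (hβ : ENNReal.log Γ.rho < (β : EReal)) (a : S.Toeplitz) :
    HasSum (fun k => S.diag (β := β) τ k a) ((∑' k, S.diag (β := β) τ k) a) :=
  (S.summable_diag τ hβ).hasSum.mapL (ContinuousLinearMap.apply ℂ ℂ a)

theorem tsum_diag_one (hβ : ENNReal.log Γ.rho < (β : EReal)) : (∑' k, S.diag (β := β) τ k) 1 = Γ.Z β τ := by
  rw [← (S.hasSum_diag τ hβ 1).tsum_eq, DirGraph.Z]
  refine tsum_congr fun k => ?_
  rw [diag_apply]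
  simp only [entry_one]

theorem Z_pos (S : SelfSimilarAction Γ) (hβ : ENNReal.log Γ.rho < (β : EReal)) : 0 < Γ.Z β τ := by
  have hs := S.hasSum_diag τ hβ 1
  rw [S.tsum_diag_one τ hβ] at hs
  have h0 : ∀ k, 0 ≤ S.diag (β := β) τ k 1 := by
    intro k
    rw [diag_apply]
    refine mul_nonneg (by exact_mod_cast (Real.exp_pos _).le) (Finset.sum_nonneg fun l _ => ?_)
    rw [entry_one]
    exact tau_u_nonneg τ _
  have h1 : S.diag (β := β) τ 0 1 = 1 := by
    rw [diag_apply]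
    simp only [entry_one]
    let e : V ≃ Γ.PathLen 0 :=
      { toFun := fun v => ⟨⟨v, [], trivial⟩, rfl⟩
        invFun := fun l => l.1.r
        left_inv := fun v => rfl
        right_inv := fun l => Subtype.ext (DirGraph.Path.ext rfl
          (List.eq_nil_of_length_eq_zero l.2).symm) }
    have : ∑ l : Γ.PathLen 0, τ (GroupoidCStar.u (𝟙 l.1.s)) =
        ∑ v : V, τ (GroupoidCStar.u (𝟙 v)) :=
      (Fintype.sum_equiv e _ _ fun v => rfl).symm
    rw [this, ← map_sum, GroupoidCStar.sum_u, τ.map_one]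
    simp
  have := le_hasSum hs 0 (fun k _ => h0 k)
  rw [h1] at this
  exact lt_of_lt_of_le one_pos this

end Psi
end SelfSimilarAction

theorem mem_cstarGen_of_mem_adjoin {A : Type*} [CStarAlgebra A] {s : Set A} {x : A}
    (hx : x ∈ StarAlgebra.adjoin ℂ s) : x ∈ cstarGen s :=
  StarSubalgebra.le_topologicalClosure _ hx

namespace SelfSimilarAction
section Psi

variable {V E : Type u} {Γ : DirGraph V E} [Groupoid.{u} V] [Fintype V] [Fintype E]
  (S : SelfSimilarAction Γ) {β : ℝ} (τ : TracialState (GroupoidCStar V))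

theorem diag_mul_u {v w : V} (g : v ⟶ w) (k : ℕ) (a : S.Toeplitz) :
    S.diag (β := β) τ k (a * S.u g) = S.diag (β := β) τ k (S.u g * a) := by
  rw [diag_apply, diag_apply]
  congr 1
  let I : Type u := {l : Γ.PathFrom v // l.1.length = k}
  have e1 : Function.Injective (fun l : I => (⟨l.1.1, l.2⟩ : Γ.PathLen k)) := fun a b h =>
    Subtype.ext (Subtype.ext (congrArg (fun x => x.1) h))
  have e2 : Function.Injective
      (fun l : I => (⟨(S.smul g l.1).1, (S.smul_length g l.1).trans l.2⟩ : Γ.PathLen k)) :=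
    fun a b h => Subtype.ext (S.smul_injective g (Subtype.ext (congrArg (fun x => x.1) h)))
  have : Finite I := Finite.of_injective _ e1
  have : Fintype I := Fintype.ofFinite I
  rw [← Fintype.sum_of_injective _ e1
    (fun l : I => τ (S.entry l.1.1 (S.smul g l.1).1 a * GroupoidCStar.u (S.restrict g l.1))) _ ?_ ?_,
    ← Fintype.sum_of_injective _ e2
    (fun l : I => τ (S.entry l.1.1 (S.smul g l.1).1 a * GroupoidCStar.u (S.restrict g l.1))) _ ?_ ?_]
  · rintro ⟨m, hm⟩ hn
    have hr : m.r ≠ w := by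
      intro hr
      refine hn ⟨⟨S.smul (Groupoid.inv g) ⟨m, hr⟩, (S.smul_length _ _).trans hm⟩, ?_⟩
      refine Subtype.ext ?_
      exact congrArg (fun z => z.1) (S.smul_inv_smul g ⟨m, hr⟩)
    rw [S.entry_u_mul_eq_zero g m m hr, map_zero]
  · rintro ⟨⟨m, hr⟩, hm⟩
    rw [S.entry_u_mul g _ m hr, τ.trace]
  · rintro ⟨m, hm⟩ hn
    have hr : m.r ≠ v := by
      intro hr
      exact hn ⟨⟨⟨m, hr⟩, hm⟩, rfl⟩
    rw [S.entry_mul_u_eq_zero g m m hr, map_zero]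
  · rintro ⟨⟨m, hr⟩, hm⟩
    rw [S.entry_mul_u g m m hr]

theorem cat_length (μ l : Γ.Path) (h : l.r = μ.s) :
    (μ.cat l h).length = μ.length + l.length := List.length_append

theorem cat_inj {μ l l' : Γ.Path} {h : l.r = μ.s} {h' : l'.r = μ.s}
    (H : μ.cat l h = μ.cat l' h') : l = l' := by
  refine DirGraph.Path.ext (h.trans h'.symm) ?_
  exact List.append_cancel_left (congrArg DirGraph.Path.edges H)

theorem entry_formula_ne {μ ν : Γ.Path} (hne : μ ≠ ν) (g : ν.s ⟶ μ.s) (k : Γ.Path) :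
    S.entry k k (S.sPath μ * S.u g * star (S.sPath ν)) = 0 := by
  by_cases h1 : ∃ (l : Γ.Path) (h : l.r = ν.s), k = ν.cat l h
  · by_cases h2 : ∃ (l : Γ.Path) (h : l.r = μ.s), k = μ.cat l h
    · obtain ⟨l, h, hk⟩ := h1
      obtain ⟨l', h', hk'⟩ := h2
      rw [S.entry_formula μ ν _ k l l' h h' hk hk']
      refine S.entry_u_ne g l' l h fun hl => hne ?_
      have h3 : l'.edges.length = l.edges.length := by
        rw [hl]; exact S.smul_length g ⟨l, h⟩
      have h4 : μ.edges ++ l'.edges = ν.edges ++ l.edges :=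
        congrArg DirGraph.Path.edges (hk'.symm.trans hk)
      have h5 := congrArg DirGraph.Path.r (hk'.symm.trans hk)
      exact DirGraph.Path.ext h5 (List.append_inj_left' h4 h3)
    · exact S.entry_formula_zero μ ν _ k (Or.inr fun l h hk => h2 ⟨l, h, hk⟩)
  · exact S.entry_formula_zero μ ν _ k (Or.inl fun l h hk => h1 ⟨l, h, hk⟩)

theorem diag_formula_lt (μ : Γ.Path) (g : μ.s ⟶ μ.s) (k : ℕ) (hk : k < μ.length) :
    S.diag (β := β) τ k (S.sPath μ * S.u g * star (S.sPath μ)) = 0 := by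
  rw [diag_apply, Finset.sum_eq_zero, mul_zero]
  rintro ⟨m, hm⟩ -
  rw [S.entry_formula_zero μ μ _ m, map_zero]
  refine Or.inl fun l h he => ?_
  have := cat_length μ l h
  rw [← he, hm] at this
  omega

theorem diag_formula (μ : Γ.Path) (g : μ.s ⟶ μ.s) (k : ℕ) :
    S.diag (β := β) τ (k + μ.length) (S.sPath μ * S.u g * star (S.sPath μ)) =
      (Real.exp (-β * μ.length) : ℂ) * ((Real.exp (-β * k) : ℂ) * S.fixedSum τ g k) := by
  rw [diag_apply, ← mul_assoc, ← Complex.ofReal_mul, ← Real.exp_add]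
  congr 1
  · congr 2; push_cast; ring
  · symm
    refine Fintype.sum_of_injective (fun l : S.FixedPaths g k =>
      (⟨μ.cat l.1.1 l.1.2, by rw [cat_length, l.2.1, add_comm]⟩ : Γ.PathLen (k + μ.length)))
      (fun a b h => Subtype.ext (Subtype.ext (cat_inj (h := a.1.2) (h' := b.1.2)
        (congrArg (fun x => x.1) h)))) _ _ ?_ ?_
    · rintro ⟨m, hm⟩ hn
      by_cases h : ∃ (l : Γ.Path) (h : l.r = μ.s), m = μ.cat l h
      · obtain ⟨l, h, rfl⟩ := h
        rw [S.entry_formula μ μ _ _ l l h h rfl rfl, S.entry_u_ne g l l h, map_zero]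
        intro hl
        rw [cat_length] at hm
        exact hn ⟨⟨⟨l, h⟩, (by omega : l.length = k), hl.symm⟩, rfl⟩
      · rw [S.entry_formula_zero μ μ _ m (Or.inl fun l hl hk => h ⟨l, hl, hk⟩), map_zero]
    · rintro ⟨⟨l, h⟩, hl, hfix⟩
      rw [S.entry_formula μ μ _ _ l l h h rfl rfl]
      have := S.entry_u g l h
      exact congrArg τ.toCLM (this.symm.trans (congrArg (fun m => S.entry m l (S.u g)) hfix))

theorem _root_.GroupoidCStar.star_u {v w : V} (g : v ⟶ w) :
    star (GroupoidCStar.u g) = GroupoidCStar.u (Groupoid.inv g) :=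
  GroupoidCStar.ext_rep fun i x => by
    rw [map_star]
    exact congrArg (fun T => T x) (i.rep.inv g).symm

theorem _root_.GroupoidCStar.exists_of_mem {y : GroupoidRep.Ambient V}
    (hy : y ∈ StarAlgebra.adjoin ℂ
      {x : GroupoidRep.Ambient V | ∃ (a b : V) (g : a ⟶ b), x = GroupoidRep.univ g}) :
    ∃ b : GroupoidCStar V, b.1 = y :=
  ⟨⟨y, mem_cstarGen_of_mem_adjoin hy⟩, rfl⟩

theorem _root_.GroupoidCStar.induction {P : GroupoidCStar V → Prop} (hc : IsClosed {a | P a})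
    (h : ∀ a : GroupoidCStar V, a.1 ∈ StarAlgebra.adjoin ℂ
      {x : GroupoidRep.Ambient V | ∃ (a b : V) (g : a ⟶ b), x = GroupoidRep.univ g} → P a)
    (a : GroupoidCStar V) : P a :=
  cstarGen_induction
    (s := {x : GroupoidRep.Ambient V | ∃ (a b : V) (g : a ⟶ b), x = GroupoidRep.univ g})
    hc (fun _ hx => h _ hx) a

theorem continuous_incl : Continuous S.incl :=
  AddMonoidHomClass.continuous_of_bound S.incl 1
    fun x => by simpa using NonUnitalStarAlgHom.norm_apply_le S.incl x

theorem trace_of_u (Φ : S.Toeplitz →L[ℂ] ℂ)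
    (h : ∀ (v w : V) (g : v ⟶ w) (x : S.Toeplitz), Φ (x * S.u g) = Φ (S.u g * x))
    (a : GroupoidCStar V) : ∀ x, Φ (x * S.incl a) = Φ (S.incl a * x) := by
  refine GroupoidCStar.induction
    (P := fun a : GroupoidCStar V => ∀ x, Φ (x * S.incl a) = Φ (S.incl a * x)) ?_ ?_ a
  · simp only [Set.ofPred_forall]
    refine isClosed_iInter fun x => isClosed_eq ?_ ?_
    · exact Φ.continuous.comp (continuous_const.mul S.continuous_incl)
    · exact Φ.continuous.comp (S.continuous_incl.mul continuous_const)
  · intro c hc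
    generalize hcy : c.1 = y at hc
    rename y ∈ _ => hy
    suffices H : ∀ b : GroupoidCStar V, b.1 = y →
        (∀ x, Φ (x * S.incl b) = Φ (S.incl b * x)) ∧
        ∀ x, Φ (x * S.incl (star b)) = Φ (S.incl (star b) * x) from (H c hcy).1
    clear hcy
    induction hy using StarAlgebra.adjoin_induction with
    | mem y hy =>
      obtain ⟨v, w, g, rfl⟩ := hy
      intro b hb
      have : b = GroupoidCStar.u g := Subtype.ext hb
      subst this
      rw [GroupoidCStar.star_u, incl_u, incl_u]
      exact ⟨h _ _ _, h _ _ _⟩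
    | algebraMap c =>
      intro b hb
      have : b = algebraMap ℂ _ c := Subtype.ext hb
      subst this
      rw [← algebraMap_star_comm, AlgHomClass.commutes, AlgHomClass.commutes]
      exact ⟨fun x => by rw [Algebra.commutes], fun x => by rw [Algebra.commutes]⟩
    | add y z hy hz iy iz =>
      intro b hb
      obtain ⟨b_y, hb_y⟩ := GroupoidCStar.exists_of_mem hy
      have H1 := iy b_y hb_y
      obtain ⟨b_z, hb_z⟩ := GroupoidCStar.exists_of_mem hz
      have H2 := iz b_z hb_z
      have : b = b_y + b_z := by subst hb_y hb_z; exact Subtype.ext hb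
      subst this
      simp only [star_add, map_add, mul_add, add_mul]
      exact ⟨fun x => by rw [H1.1, H2.1], fun x => by rw [H1.2, H2.2]⟩
    | mul y z hy hz iy iz =>
      intro b hb
      obtain ⟨b_y, hb_y⟩ := GroupoidCStar.exists_of_mem hy
      have H1 := iy b_y hb_y
      obtain ⟨b_z, hb_z⟩ := GroupoidCStar.exists_of_mem hz
      have H2 := iz b_z hb_z
      have : b = b_y * b_z := by subst hb_y hb_z; exact Subtype.ext hb
      subst this
      simp only [star_mul, map_mul]
      exact ⟨fun x => by rw [← mul_assoc, H2.1, ← mul_assoc, H1.1, mul_assoc],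
        fun x => by rw [← mul_assoc, H1.2, ← mul_assoc, H2.2, mul_assoc]⟩
    | star y hy iy =>
      intro b hb
      obtain ⟨b_y, hb_y⟩ := GroupoidCStar.exists_of_mem hy
      have H1 := iy b_y hb_y
      have : b = star b_y := by subst hb_y; exact Subtype.ext hb
      subst this
      rw [star_star]
      exact ⟨H1.2, H1.1⟩

open Classical in
/-- Existence of the state `Ψ_{β,τ}`. -/
theorem exists_psi (hβ : ENNReal.log Γ.rho < (β : EReal)) :
    ∃ Ψ : CStarState S.Toeplitz,
      (∀ (μ ν : Γ.Path) (g : ν.s ⟶ μ.s), Ψ (S.sPath μ * S.u g * star (S.sPath ν)) =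
        if μ = ν then (Real.exp (-β * μ.length) : ℂ) * (Γ.Z β τ)⁻¹ *
          ∑' k : ℕ, (Real.exp (-β * k) : ℂ) * S.fixedSum τ g k else 0) ∧
      ∀ a b : GroupoidCStar V, Ψ (S.incl (a * b)) = Ψ (S.incl (b * a)) := by
  have hZ := Z_pos τ S hβ
  refine ⟨⟨(Γ.Z β τ)⁻¹ • ∑' k, S.diag (β := β) τ k, fun a => ?_, ?_⟩, ?_, ?_⟩
  · rw [smul_apply, smul_eq_mul, ← (S.hasSum_diag τ hβ _).tsum_eq]
    refine mul_nonneg (inv_nonneg.2 hZ.le) (tsum_nonneg fun k => ?_)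
    rw [diag_apply]
    exact mul_nonneg (by exact_mod_cast (Real.exp_pos _).le)
      (Finset.sum_nonneg fun l _ => S.tau_entry_nonneg τ _ _)
  · rw [smul_apply, smul_eq_mul, S.tsum_diag_one τ hβ, inv_mul_cancel₀ hZ.ne']
  · intro μ ν g
    change ((Γ.Z β τ)⁻¹ • ∑' k, S.diag (β := β) τ k) _ = _
    rw [smul_apply, smul_eq_mul, ← (S.hasSum_diag τ hβ _).tsum_eq]
    split_ifs with h
    · subst h
      have hs := (S.hasSum_diag τ hβ (S.sPath μ * S.u g * star (S.sPath μ))).summable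
      rw [← hs.sum_add_tsum_nat_add μ.length, Finset.sum_eq_zero, zero_add]
      · simp only [diag_formula]
        rw [tsum_mul_left]
        ring
      · intro k hk
        exact S.diag_formula_lt τ μ g k (Finset.mem_range.1 hk)
    · have : ∀ k, S.diag (β := β) τ k (S.sPath μ * S.u g * star (S.sPath ν)) = 0 := by
        intro k
        rw [diag_apply, Finset.sum_eq_zero, mul_zero]
        intro m _
        rw [S.entry_formula_ne h, map_zero]
      simp [this]
  · intro a b
    rw [map_mul S.incl, map_mul S.incl]
    refine S.trace_of_u _ (fun v w g x => ?_) b _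
    rw [smul_apply, smul_apply, ← (S.hasSum_diag τ hβ _).tsum_eq,
      ← (S.hasSum_diag τ hβ _).tsum_eq]
    simp only [diag_mul_u]

end Psi
end SelfSimilarAction

/-! ### The states `Ψ_{β,τ}` and the map `χ_β` -/

namespace SelfSimilarAction

variable {V E : Type u} {Γ : DirGraph V E} [Groupoid.{u} V] [Fintype V] [Fintype E]
  (S : SelfSimilarAction Γ) {β : ℝ} (hβ : ENNReal.log Γ.rho < (β : EReal))
  (τ : TracialState (GroupoidCStar V))

/-- The state `Ψ_{β,τ}` of the Toeplitz algebra. -/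
noncomputable def Psi : CStarState S.Toeplitz := (S.exists_psi τ hβ).choose

open Classical in
/-- The formula for `Ψ_{β,τ}`. As the elements `s_μ u_g s_ν^*` span a dense subspace of the
Toeplitz algebra, it determines the state. -/
theorem Psi_apply (μ ν : Γ.Path) (g : ν.s ⟶ μ.s) :
    S.Psi hβ τ (S.sPath μ * S.u g * star (S.sPath ν)) =
      if μ = ν then (Real.exp (-β * μ.length) : ℂ) * (Γ.Z β τ)⁻¹ *
        ∑' k : ℕ, (Real.exp (-β * k) : ℂ) * S.fixedSum τ g k else 0 :=
  (S.exists_psi τ hβ).choose_spec.1 μ ν g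

/-- The map `χ_β : Tr(C^*(𝒢)) → Tr(C^*(𝒢))`, `χ_β(τ) = Ψ_{β,τ}|_{C^*(𝒢)}`. -/
noncomputable def chi : TracialState (GroupoidCStar V) where
  toCLM := (S.Psi hβ τ).toCLM.comp
    { toLinearMap := S.incl.toAlgHom.toLinearMap
      cont := S.continuous_incl }
  nonneg a := by
    have := (S.Psi hβ τ).nonneg (S.incl a)
    rw [← map_star S.incl, ← map_mul S.incl] at this
    exact this
  map_one := by
    have := (S.Psi hβ τ).map_one
    rw [← map_one S.incl] at this
    exact this
  trace a b := (S.exists_psi τ hβ).choose_spec.2 a b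

theorem chi_apply (a : GroupoidCStar V) : S.chi hβ τ a = S.Psi hβ τ (S.incl a) := rfl

end SelfSimilarAction

/-!
Everything rests on one recursion.  A path of length `n + 1` fixed by `g` is an edge `e` fixed by
`g` followed by a path of length `n` fixed by `g|_e`, so the sums
`T_n(g) = ∑_{μ ∈ d(g) Eⁿ, g · μ = μ} τ(u_{g|_μ})` satisfy `T_{n + 1}(g) = ∑_e T_n(g|_e)`
(`fixedSum_succ`), and `T_0(g) = τ(u_g)` (`fixedSum_zero`).

For a fixed point of `χ_β`, the formula for `Ψ_{β,τ}` reads `Z τ(u_g) = ∑_k e^{-βk} T_k(g)`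
(`hasSum_fixedSum_of_chi_eq`).  Splitting off the term `k = 0` and applying the recursion and the
same formula to every `g|_e` gives `(Z - 1) τ(u_g) = e^{-β} Z T_1(g)`, that is,
`N τ(u_g) = T_1(g)`.  The recursion then yields `N^n τ(u_g) = T_n(g)` by induction.

For the second part, the identity for `g = v` and `n = 1` says `A_E m = N m` for
`m_v = τ(u_v)`, a nonnegative vector with sum `1`.  If `m_w ≠ 0` and `μ` is a path from `w` to `v`,
then `m_w` is one of the terms of `T_{|μ|}(v) = N^{|μ|} m_v`, whence `m_v ≠ 0`.  Finally, an
eigenvalue with a strictly positive eigenvector of a nonnegative matrix is its spectral radius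
(`Matrix.spectralRadius_eq_of_mulVec_eq_smul`): in the sup norm weighted by that eigenvector
the matrix has operator norm equal to the eigenvalue.
-/

/-! ### Nonnegative matrices with a positive eigenvector -/

/-- An eigenvector `y` for an arbitrary eigenvalue `μ` is compared with the positive eigenvector
`x` at an index where `|y i| / |x i|` is maximal. -/
theorem Matrix.spectralRadius_eq_of_mulVec_eq_smul {n : Type*} [Fintype n] [DecidableEq n]
    [Nonempty n] {A : Matrix n n ℂ} (hA : ∀ i j, 0 ≤ A i j) {x : n → ℂ} (hx : ∀ i, 0 < x i)
    {r : ℂ} (h : A.mulVec x = r • x) : spectralRadius ℂ A = (‖r‖₊ : ℝ≥0∞) := by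
  have hxn : ∀ i, 0 < ‖x i‖ := fun i => norm_pos_iff.2 (hx i).ne'
  rw [spectralRadius, ← Matrix.spectrum_toLin']
  refine le_antisymm (iSup₂_le fun μ hμ => ?_) ?_
  · obtain ⟨y, hy⟩ := (Module.End.hasEigenvalue_iff_mem_spectrum.2 hμ).exists_hasEigenvector
    have hy0 : y ≠ 0 := hy.2
    have hAy : A.mulVec y = μ • y := by
      rw [← Matrix.toLin'_apply]; exact hy.apply_eq_smul
    obtain ⟨i, hi⟩ := Finite.exists_max fun i => ‖y i‖ / ‖x i‖
    have hle : ∀ j, ‖y j‖ ≤ ‖y i‖ / ‖x i‖ * ‖x j‖ := fun j => (div_le_iff₀ (hxn j)).1 (hi j)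
    have hyi : 0 < ‖y i‖ := by
      refine norm_pos_iff.2 fun h0 => hy0 (funext fun j => ?_)
      have := hle j
      rw [h0, norm_zero, zero_div, zero_mul] at this
      exact norm_le_zero_iff.1 this
    have hsum : ∑ j, ‖A i j‖ * ‖x j‖ = ‖r‖ * ‖x i‖ := by
      have h1 := congrFun h i
      simp only [Matrix.mulVec, dotProduct, Pi.smul_apply, smul_eq_mul] at h1
      rw [← norm_mul, ← h1]
      have h2 : ∑ j, A i j * x j = ((∑ j, ‖A i j‖ * ‖x j‖ : ℝ) : ℂ) := by
        push_cast
        refine Finset.sum_congr rfl fun j _ => ?_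
        rw [← Complex.eq_coe_norm_of_nonneg (hA i j), ← Complex.eq_coe_norm_of_nonneg (hx j).le]
      rw [h2, Complex.norm_real, Real.norm_of_nonneg (by positivity)]
    have key : ‖μ‖ * ‖y i‖ ≤ ‖r‖ * ‖y i‖ := by
      have h1 := congrFun hAy i
      simp only [Matrix.mulVec, dotProduct, Pi.smul_apply, smul_eq_mul] at h1
      calc ‖μ‖ * ‖y i‖ = ‖∑ j, A i j * y j‖ := by rw [h1, norm_mul]
        _ ≤ ∑ j, ‖A i j‖ * (‖y i‖ / ‖x i‖ * ‖x j‖) := by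
          refine (norm_sum_le _ _).trans (Finset.sum_le_sum fun j _ => ?_)
          rw [norm_mul]
          exact mul_le_mul_of_nonneg_left (hle j) (norm_nonneg _)
        _ = ‖y i‖ / ‖x i‖ * ∑ j, ‖A i j‖ * ‖x j‖ := by
          rw [Finset.mul_sum]
          exact Finset.sum_congr rfl fun j _ => by ring
        _ = ‖r‖ * ‖y i‖ := by
          rw [hsum]
          field_simp [(hxn i).ne']
    exact_mod_cast le_of_mul_le_mul_right key hyi
  · have hr : Module.End.HasEigenvalue (Matrix.toLin' A) r := by
      refine Module.End.hasEigenvalue_of_hasEigenvector (x := x) ⟨?_, fun h0 => ?_⟩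
      · rw [Module.End.mem_eigenspace_iff, Matrix.toLin'_apply, h]
      · obtain ⟨i⟩ := ‹Nonempty n›
        exact (hx i).ne' (congrFun h0 i)
    exact le_iSup₂ (f := fun k (_ : k ∈ spectrum ℂ (Matrix.toLin' A)) => (‖k‖₊ : ℝ≥0∞)) r
      hr.mem_spectrum

/-! ### Traces of groupoid elements -/

section

variable {V : Type u} [Groupoid.{u} V] [Fintype V]

open SelfSimilarAction (arr)

theorem GroupoidCStar.u_congr {a b c d : V} {g : a ⟶ b} {h : c ⟶ d} (H : arr g = arr h) :
    GroupoidCStar.u g = GroupoidCStar.u h :=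
  congrArg (fun x : Σ a b : V, (a ⟶ b) => GroupoidCStar.u x.2.2) H

theorem GroupoidCStar.u_mul_u {a b c : V} (g : b ⟶ c) (h : a ⟶ b) :
    GroupoidCStar.u g * GroupoidCStar.u h = GroupoidCStar.u (h ≫ g) :=
  GroupoidCStar.ext_rep fun i x => by
    rw [map_mul]
    exact congrArg (fun T => T x) (i.rep.mul g h)

theorem GroupoidCStar.u_mul_u_eq_zero {a b b' c : V} (g : b' ⟶ c) (h : a ⟶ b) (hne : b' ≠ b) :
    GroupoidCStar.u g * GroupoidCStar.u h = 0 :=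
  GroupoidCStar.ext_rep fun i x => by
    rw [map_mul, map_zero]
    exact congrArg (fun T => T x) (i.rep.mul_eq_zero g h hne)

/-- A trace vanishes on `u_g = u_{t(g)} u_g` if `g` is not in an isotropy group, because then
`u_g u_{t(g)} = 0`. -/
theorem TracialState.apply_u_eq_zero (τ : TracialState (GroupoidCStar V)) {v w : V} (g : v ⟶ w)
    (h : v ≠ w) : τ (GroupoidCStar.u g) = 0 := by
  have h1 := GroupoidCStar.u_mul_u (𝟙 w) g
  rw [Category.comp_id] at h1
  rw [← h1, τ.trace, GroupoidCStar.u_mul_u_eq_zero _ _ h, map_zero]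

end

/-! ### Paths fixed by a groupoid element -/

namespace SelfSimilarAction

variable {V E : Type u} {Γ : DirGraph V E} [Groupoid.{u} V] [Fintype V] [Fintype E]
  (S : SelfSimilarAction Γ)

theorem isEmpty_fixedPaths {v w : V} (g : v ⟶ w) (h : v ≠ w) (n : ℕ) :
    IsEmpty (S.FixedPaths g n) :=
  ⟨fun μ => h (μ.1.2.symm.trans ((congrArg DirGraph.Path.r μ.2.2).symm.trans
    (S.smul g μ.1).2))⟩

theorem fixedSum_eq_zero (τ : TracialState (GroupoidCStar V)) {v w : V} (g : v ⟶ w) (h : v ≠ w)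
    (n : ℕ) : S.fixedSum τ g n = 0 := by
  have := S.isEmpty_fixedPaths g h n
  rw [fixedSum, Fintype.sum_empty]

theorem smul_vertexPath {v w : V} (g : v ⟶ w) : S.smul g (Γ.vertexPath v) = Γ.vertexPath w :=
  DirGraph.PathFrom.ext (List.eq_nil_of_length_eq_zero (S.smul_length g (Γ.vertexPath v)))

theorem arr_restrict_vertexPath {v w : V} (g : v ⟶ w) :
    arr (S.restrict g (Γ.vertexPath v)) = arr g := by
  refine S.arr_eq_restrict g _ g rfl (by rw [smul_vertexPath]; rfl) fun ν => ?_
  rw [smul_vertexPath]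
  have : (Γ.vertexPath v).append ⟨ν.1, ν.2.trans rfl⟩ = ν := DirGraph.PathFrom.ext rfl
  rw [this]
  rfl

theorem fixedSum_zero (τ : TracialState (GroupoidCStar V)) {v w : V} (g : v ⟶ w) :
    S.fixedSum τ g 0 = τ (GroupoidCStar.u g) := by
  by_cases h : v = w
  · subst h
    let μ : S.FixedPaths g 0 := ⟨Γ.vertexPath v, rfl, by rw [smul_vertexPath]⟩
    have hμ : ∀ ν : S.FixedPaths g 0, ν = μ := fun ν =>
      Subtype.ext (DirGraph.PathFrom.ext (List.eq_nil_of_length_eq_zero ν.2.1))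
    rw [fixedSum, Fintype.sum_eq_single μ fun ν hν => absurd (hμ ν) hν]
    exact congrArg τ.toCLM (GroupoidCStar.u_congr (S.arr_restrict_vertexPath g))
  · rw [S.fixedSum_eq_zero τ g h, τ.apply_u_eq_zero g h]

/-- A path `μν` is fixed by `g` if and only if `μ` is fixed by `g` and `ν` by `g|_μ`. -/
theorem smul_append_eq_iff {v w : V} (g : v ⟶ w) (μ : Γ.PathFrom v) (ν : Γ.PathFrom μ.1.s) :
    (S.smul g (μ.append ν)).1 = (μ.append ν).1 ↔
      (S.smul g μ).1 = μ.1 ∧ (S.smul (S.restrict g μ) ν).1 = ν.1 := by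
  rw [smul_append]
  constructor
  · intro h
    have hr := congrArg DirGraph.Path.r h
    obtain ⟨h1, h2⟩ := List.append_inj (congrArg DirGraph.Path.edges h) (S.smul_length g μ)
    have hμ : (S.smul g μ).1 = μ.1 := DirGraph.Path.ext hr h1
    refine ⟨hμ, DirGraph.Path.ext ?_ h2⟩
    rw [(S.smul (S.restrict g μ) ν).2, ν.2, hμ]
  · rintro ⟨h1, h2⟩
    have hr := congrArg DirGraph.Path.r h1
    exact DirGraph.Path.ext hr (congrArg₂ (· ++ ·) (congrArg DirGraph.Path.edges h1)
      (congrArg DirGraph.Path.edges h2))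

/-- The first edge of a fixed path of length `n + 1` is fixed, and the rest is fixed by the
restriction to that edge. -/
theorem fixedSum_succ (τ : TracialState (GroupoidCStar V)) {v w : V} (g : v ⟶ w) (n : ℕ) :
    S.fixedSum τ g (n + 1) = ∑ μ : S.FixedPaths g 1, S.fixedSum τ (S.restrict g μ.1) n := by
  simp only [fixedSum]
  rw [← Fintype.sum_sigma' (fun (μ : S.FixedPaths g 1)
    (ν : S.FixedPaths (S.restrict g μ.1) n) =>
      τ (GroupoidCStar.u (S.restrict (S.restrict g μ.1) ν.1)))]
  let f : (Σ μ : S.FixedPaths g 1, S.FixedPaths (S.restrict g μ.1) n) → S.FixedPaths g (n + 1) :=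
    fun x => ⟨x.1.1.append x.2.1, by
      have h1 := x.1.2.1
      have h2 := x.2.2.1
      simp only [DirGraph.Path.length] at h1 h2 ⊢
      rw [DirGraph.PathFrom.append_edges, List.length_append, h1, h2, add_comm],
      (S.smul_append_eq_iff g _ _).2 ⟨x.1.2.2, x.2.2.2⟩⟩
  symm
  refine Fintype.sum_bijective f ⟨?_, ?_⟩ _ _ ?_
  · rintro ⟨⟨μ, hμ, hgμ⟩, ⟨ν, hν, hgν⟩⟩ ⟨⟨μ', hμ', hgμ'⟩, ⟨ν', hν', hgν'⟩⟩ h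
    have h0 : μ.1.edges ++ ν.1.edges = μ'.1.edges ++ ν'.1.edges :=
      congrArg (fun x => x.1.1.edges) h
    obtain ⟨h1, h2⟩ := List.append_inj h0 (hμ.trans hμ'.symm)
    obtain rfl : μ = μ' := DirGraph.PathFrom.ext h1
    obtain rfl : ν = ν' := DirGraph.PathFrom.ext h2
    rfl
  · rintro ⟨⟨⟨r, l, hp⟩, hr⟩, hl, hg⟩
    cases l with
    | nil => simp [DirGraph.Path.length] at hl
    | cons e l =>
      have hl' : l.length = n := by simpa [DirGraph.Path.length] using hl
      let μ : Γ.PathFrom v := ⟨(Γ.edgePath e).1, hp.1.trans hr⟩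
      let ν : Γ.PathFrom μ.1.s := ⟨⟨Γ.s e, l, hp.2⟩, rfl⟩
      have hμν : (⟨⟨r, e :: l, hp⟩, hr⟩ : Γ.PathFrom v) = μ.append ν :=
        DirGraph.PathFrom.ext rfl
      rw [hμν] at hg
      obtain ⟨h1, h2⟩ := (S.smul_append_eq_iff g μ ν).1 hg
      exact ⟨⟨⟨μ, rfl, h1⟩, ⟨ν, hl', h2⟩⟩, Subtype.ext hμν.symm⟩
  · rintro ⟨μ, ν⟩
    exact congrArg τ.toCLM (GroupoidCStar.u_congr (S.arr_restrict_append g μ.1 ν.1).symm)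

/-! ### Fixed points of `χ_β` -/

theorem sPath_vertexPath (v : V) : S.sPath (Γ.vertexPath v).1 = S.u (𝟙 v) := mul_one _

theorem sPath_mul_u_mul_star_sPath {v : V} (g : v ⟶ v) :
    S.sPath (Γ.vertexPath v).1 * S.u g * star (S.sPath (Γ.vertexPath v).1) = S.u g := by
  have hinv : Groupoid.inv (𝟙 v) = 𝟙 v := by
    rw [← Category.comp_id (Groupoid.inv (𝟙 v)), Groupoid.inv_comp]
  rw [sPath_vertexPath, star_u, hinv, ← incl_u, ← incl_u, ← map_mul, ← map_mul,
    GroupoidCStar.u_mul_u, GroupoidCStar.u_mul_u, Category.comp_id, Category.id_comp]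

variable {β : ℝ} (hβ : ENNReal.log Γ.rho < (β : EReal)) {τ : TracialState (GroupoidCStar V)}

theorem summable_fixedSum (hβ : ENNReal.log Γ.rho < (β : EReal))
    (τ : TracialState (GroupoidCStar V)) {v w : V} (g : v ⟶ w) :
    Summable fun k : ℕ => (Real.exp (-β * k) : ℂ) * S.fixedSum τ g k := by
  by_cases h : v = w
  · subst h
    refine (S.hasSum_diag τ hβ (S.sPath (Γ.vertexPath v).1 * S.u g *
      star (S.sPath (Γ.vertexPath v).1))).summable.congr fun k => ?_
    refine (S.diag_formula (β := β) τ (Γ.vertexPath v).1 g k).trans ?_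
    have h0 : (Γ.vertexPath v).1.length = 0 := rfl
    simp [h0]
    rfl
  · simp only [S.fixedSum_eq_zero τ g h, mul_zero]
    exact summable_zero

theorem hasSum_fixedSum_of_chi_eq (h : S.chi hβ τ = τ) {v w : V} (g : v ⟶ w) :
    HasSum (fun k : ℕ => (Real.exp (-β * k) : ℂ) * S.fixedSum τ g k)
      (Γ.Z β τ * τ (GroupoidCStar.u g)) := by
  by_cases hvw : v = w
  · subst hvw
    have h1 : τ (GroupoidCStar.u g) = S.Psi hβ τ (S.u g) := by
      conv_lhs => rw [← h]
      rfl
    have h2 := (congrArg (S.Psi hβ τ).toCLM (S.sPath_mul_u_mul_star_sPath g)).symm.trans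
      (S.Psi_apply hβ τ (Γ.vertexPath v).1 (Γ.vertexPath v).1 g)
    have h0 : (Γ.vertexPath v).1.length = 0 := rfl
    rw [← h1, if_pos rfl, h0] at h2
    rw [h2, Nat.cast_zero, mul_zero, Real.exp_zero, Complex.ofReal_one, one_mul, ← mul_assoc,
      mul_inv_cancel₀ (Z_pos τ S hβ).ne', one_mul]
    exact (S.summable_fixedSum hβ τ g).hasSum
  · simp only [S.fixedSum_eq_zero τ g hvw, τ.apply_u_eq_zero g hvw, mul_zero]
    exact hasSum_zero

/-- Comparison of the series for `g` without its term `k = 0` with the sum of the series for the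
restrictions `g|_e` to the fixed edges `e`. -/
theorem N_mul_of_chi_eq (h : S.chi hβ τ = τ) {v w : V} (g : v ⟶ w) :
    Γ.N β τ * τ (GroupoidCStar.u g) =
      ∑ μ : S.FixedPaths g 1, τ (GroupoidCStar.u (S.restrict g μ.1)) := by
  have h1 := (hasSum_nat_add_iff' 1).2 (S.hasSum_fixedSum_of_chi_eq hβ h g)
  have h2 := (hasSum_sum fun (μ : S.FixedPaths g 1) (_ : μ ∈ Finset.univ) =>
    S.hasSum_fixedSum_of_chi_eq hβ h (S.restrict g μ.1)).mul_left (Real.exp (-β) : ℂ)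
  have h3 : ∀ k : ℕ, (Real.exp (-β * (k + 1 : ℕ)) : ℂ) * S.fixedSum τ g (k + 1) =
      (Real.exp (-β) : ℂ) * ∑ μ : S.FixedPaths g 1,
        (Real.exp (-β * k) : ℂ) * S.fixedSum τ (S.restrict g μ.1) k := by
    intro k
    rw [fixedSum_succ, ← Finset.mul_sum, ← mul_assoc, ← Complex.ofReal_mul, ← Real.exp_add]
    congr 3
    push_cast
    ring
  simp only [h3] at h1
  have h4 := h1.unique h2
  rw [← Finset.mul_sum, Finset.sum_range_one, fixedSum_zero] at h4
  simp only [Nat.cast_zero, mul_zero, Real.exp_zero, Complex.ofReal_one, one_mul] at h4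
  have hZ : Γ.Z β τ ≠ 0 := (Z_pos τ S hβ).ne'
  have hexp : (Real.exp β : ℂ) * Real.exp (-β) = 1 := by
    rw [← Complex.ofReal_mul, ← Real.exp_add, add_neg_cancel, Real.exp_zero, Complex.ofReal_one]
  calc Γ.N β τ * τ (GroupoidCStar.u g)
      = Real.exp β * (Γ.Z β τ)⁻¹ *
          (Γ.Z β τ * τ (GroupoidCStar.u g) - τ (GroupoidCStar.u g)) := by
        rw [DirGraph.N]
        field_simp
    _ = (Real.exp β * Real.exp (-β)) * ((Γ.Z β τ)⁻¹ * Γ.Z β τ) *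
          ∑ μ : S.FixedPaths g 1, τ (GroupoidCStar.u (S.restrict g μ.1)) := by
        rw [h4]
        ring
    _ = _ := by rw [hexp, inv_mul_cancel₀ hZ, one_mul, one_mul]

theorem N_pow_mul_of_chi_eq (h : S.chi hβ τ = τ) {v w : V} (g : v ⟶ w) (n : ℕ) :
    Γ.N β τ ^ n * τ (GroupoidCStar.u g) = S.fixedSum τ g n := by
  induction n generalizing v w with
  | zero => rw [pow_zero, one_mul, fixedSum_zero]
  | succ n ih =>
    rw [pow_succ, mul_assoc, S.N_mul_of_chi_eq hβ h, fixedSum_succ, Finset.mul_sum]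
    exact Finset.sum_congr rfl fun μ _ => ih _

/-! ### The vector of traces of the vertices -/

theorem apply_u_restrict_id (τ : TracialState (GroupoidCStar V)) {v : V} (μ : Γ.PathFrom v) :
    τ (GroupoidCStar.u (S.restrict (𝟙 v) μ)) = τ (GroupoidCStar.u (𝟙 μ.1.s)) :=
  congrArg τ.toCLM (GroupoidCStar.u_congr (S.arr_restrict_id μ))

theorem fixedSum_id_one (τ : TracialState (GroupoidCStar V)) (v : V) :
    S.fixedSum τ (𝟙 v) 1 = Γ.adjMatrix.mulVec (fun w => τ (GroupoidCStar.u (𝟙 w))) v := by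
  classical
  have h1 : ∀ w, Γ.adjMatrix v w = ∑ e : {e : E // Γ.r e = v}, if Γ.s e.1 = w then 1 else 0 := by
    intro w
    rw [Finset.sum_boole]
    simp only [DirGraph.adjMatrix]
    congr 1
    rw [← Fintype.card_subtype, ← Nat.card_eq_fintype_card]
    exact Nat.card_congr (Equiv.subtypeSubtypeEquivSubtypeInter _ _).symm
  have h2 : Γ.adjMatrix.mulVec (fun w => τ (GroupoidCStar.u (𝟙 w))) v =
      ∑ e : {e : E // Γ.r e = v}, τ (GroupoidCStar.u (𝟙 (Γ.s e.1))) := by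
    simp only [Matrix.mulVec, dotProduct, h1, Finset.sum_mul]
    rw [Finset.sum_comm]
    exact Finset.sum_congr rfl fun e _ => by simp
  let f : {e : E // Γ.r e = v} → S.FixedPaths (𝟙 v) 1 :=
    fun e => ⟨⟨(Γ.edgePath e.1).1, e.2⟩, rfl, by rw [smul_id]⟩
  rw [h2, fixedSum]
  symm
  refine Fintype.sum_bijective f ⟨fun e e' h => ?_, ?_⟩ _ _ fun e =>
    (S.apply_u_restrict_id τ (f e).1).symm
  · have h' : [e.1] = [e'.1] := congrArg (fun μ => μ.1.1.edges) h
    exact Subtype.ext (List.singleton_inj.1 h')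
  · rintro ⟨⟨⟨r, l, hp⟩, hr⟩, hl, hg⟩
    obtain ⟨e, rfl⟩ := List.length_eq_one_iff.1 hl
    exact ⟨⟨e, hp.1.trans hr⟩, Subtype.ext (DirGraph.PathFrom.ext rfl)⟩

/-- If `τ(u_w) > 0` for some `w`, then strong connectedness spreads positivity to every vertex
`v`: with `μ` a path from `w` to `v`, the number `τ(u_w)` is a term of `T_{|μ|}(v)`. -/
theorem apply_u_id_pos (hsc : Γ.StronglyConnected) {N : ℂ}
    (h : ∀ (v : V) (n : ℕ), 1 ≤ n → N ^ n * τ (GroupoidCStar.u (𝟙 v)) = S.fixedSum τ (𝟙 v) n)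
    (v : V) : 0 < τ (GroupoidCStar.u (𝟙 v)) := by
  obtain ⟨w, hw⟩ : ∃ w : V, 0 < τ (GroupoidCStar.u (𝟙 w)) := by
    by_contra! hall
    have hsum : ∑ w : V, τ (GroupoidCStar.u (𝟙 w)) = 1 := by
      rw [← map_sum, GroupoidCStar.sum_u, τ.map_one]
    refine zero_ne_one ((Finset.sum_eq_zero fun w _ => ?_).symm.trans hsum)
    by_contra hne
    exact hall w (lt_of_le_of_ne (tau_u_nonneg τ w) (Ne.symm hne))
  obtain ⟨μ, hμ⟩ := hsc v w
  refine lt_of_le_of_ne (tau_u_nonneg τ v) fun h0 => ?_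
  have hpos : 0 < S.fixedSum τ (𝟙 v) μ.1.length := by
    refine Finset.sum_pos' (fun ν _ => ?_)
      ⟨(⟨μ, rfl, by rw [smul_id]⟩ : S.FixedPaths (𝟙 v) μ.1.length), Finset.mem_univ _, ?_⟩
    · rw [apply_u_restrict_id]
      exact tau_u_nonneg τ _
    · rw [apply_u_restrict_id, hμ]
      exact hw
  rcases Nat.eq_zero_or_pos μ.1.length with hn | hn
  · rw [hn, fixedSum_zero, ← h0] at hpos
    exact hpos.false
  · rw [← h v _ hn, ← h0, mul_zero] at hpos
    exact hpos.false

end SelfSimilarAction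

theorem proposition2p3 {V E : Type u} [Groupoid.{u} V] [Fintype V] [Fintype E]
    (Γ : DirGraph V E) (S : SelfSimilarAction Γ) (β : ℝ)
    (hβ : ENNReal.log Γ.rho < (β : EReal)) :
    (∀ τ : TracialState (GroupoidCStar V), S.chi hβ τ = τ →
      ∀ (v w : V) (g : v ⟶ w) (n : ℕ), 1 ≤ n →
        Γ.N β τ ^ n * τ (GroupoidCStar.u g) =
          ∑ μ : S.FixedPaths g n, τ (GroupoidCStar.u (S.restrict g μ.1))) ∧
    (Γ.StronglyConnected → ∀ τ : TracialState (GroupoidCStar V),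
      (∀ (v w : V) (g : v ⟶ w) (n : ℕ), 1 ≤ n →
        Γ.N β τ ^ n * τ (GroupoidCStar.u g) =
          ∑ μ : S.FixedPaths g n, τ (GroupoidCStar.u (S.restrict g μ.1))) →
      Γ.IsPerronFrobeniusEigenvector (fun v => τ (GroupoidCStar.u (𝟙 v))) ∧
        Γ.N β τ = (Γ.rho.toReal : ℂ)) := by
  refine ⟨fun τ h v w g n _ => S.N_pow_mul_of_chi_eq hβ h g n, fun hsc τ h => ?_⟩
  have hpos := S.apply_u_id_pos hsc fun v n hn => h v v (𝟙 v) n hn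
  have hsum : ∑ v : V, τ (GroupoidCStar.u (𝟙 v)) = 1 := by
    rw [← map_sum, GroupoidCStar.sum_u, τ.map_one]
  have heig : Γ.adjMatrix.mulVec (fun v => τ (GroupoidCStar.u (𝟙 v))) =
      Γ.N β τ • fun v => τ (GroupoidCStar.u (𝟙 v)) := by
    funext v
    rw [← S.fixedSum_id_one τ v, Pi.smul_apply, smul_eq_mul, ← pow_one (Γ.N β τ)]
    exact (h v v (𝟙 v) 1 le_rfl).symm
  have hA : ∀ v w, 0 ≤ Γ.adjMatrix v w := fun v w => Nat.cast_nonneg _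
  have : Nonempty V := by
    by_contra hV
    rw [not_nonempty_iff] at hV
    rw [Fintype.sum_empty] at hsum
    exact zero_ne_one hsum
  -- `N` is the sum of the entries of `N m = A_E m`.
  have hN : 0 ≤ Γ.N β τ := by
    rw [← mul_one (Γ.N β τ), ← hsum, Finset.mul_sum]
    refine Finset.sum_nonneg fun v _ => ?_
    have h1 := congrFun heig v
    rw [Pi.smul_apply, smul_eq_mul] at h1
    rw [← h1]
    exact Finset.sum_nonneg fun w _ => mul_nonneg (hA v w) (hpos w).le
  have hrho : Γ.N β τ = (Γ.rho.toReal : ℂ) := by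
    classical
    rw [DirGraph.rho, Matrix.spectralRadius_eq_of_mulVec_eq_smul hA hpos heig]
    exact Complex.eq_coe_norm_of_nonneg hN
  exact ⟨⟨hpos, hsum, by rw [← hrho]; exact heig⟩, hrho⟩
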